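/- Let $\nu(s)=\zeta(s)\zeta''(s)-\zeta'(s)^2$. For $\operatorname{Re}(s)>1$ one has the absolutely convergent Dirichlet series $$\nu(s)=\sum_{n\ge 1}\frac{a(n)}{n^{s}},\qquad a(n)=\sum_{d\mid n}\bigl(\log^2 d-\log d\,\log(n/d)\bigr).$$ Let $A(x)=\sum_{1\le n<x}a(n)$ and $$p(t)=\frac{t^3}{6}+\Bigl(C_0-\frac12\Bigr)t^2+\bigl(1-4C_1-2C_0\bigr)t+4C_2+4C_1+2C_0-1,$$ where $C_0$ is Euler's constant and $C_1,C_2$ are the Stieltjes constants $$C_k=\lim_{N\to\infty}\Bigl(\sum_{m=1}^{N}\frac{(\log m)^k}{m}-\frac{(\log N)^{k+1}}{k+1}\Bigr).$$ Then for every $\varepsilon>0$ there is a constant $C(\varepsilon)$ such that for all real $x\ge 1$ $$\bigl|A(x)-x\,p(\log x)\bigr|\le C(\varepsilon)\,x^{1/3+\varepsilon},$$ that is, $A(x)=x\,p(\log x)+O_\varepsilon\bigl(x^{1/3+\varepsilon}\bigr)$. -/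

import Mathlib

open Filter Topology

/-- The `N`-th approximation `∑_{m ≤ N} (log m)^k / m - (log N)^(k+1) / (k+1)` to the `k`-th
Stieltjes constant. -/
noncomputable def stieltjesSeq (k N : ℕ) : ℝ :=
  ∑ m ∈ Finset.Icc 1 N, Real.log m ^ k / m - Real.log N ^ (k + 1) / (k + 1)

/-- The `k`-th Stieltjes constant, `lim_{N → ∞} stieltjesSeq k N`. The limit exists, see
`tendsto_stieltjesSeq`. -/
noncomputable def stieltjesConst (k : ℕ) : ℝ :=
  limUnder atTop (stieltjesSeq k)

theorem stieltjes_antitone (k : ℕ) :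
    AntitoneOn (fun x : ℝ => Real.log x ^ k / x) (Set.Ici (Real.exp k)) := by
  intro x hx y hy hxy
  have hx0 : 0 < x := (Real.exp_pos _).trans_le hx
  have hy0 : 0 < y := hx0.trans_le hxy
  rcases Nat.eq_zero_or_pos k with rfl | hk
  · simpa using inv_anti₀ hx0 hxy
  have hkR : (0 : ℝ) < k := by exact_mod_cast hk
  have key : ∀ z : ℝ, 0 < z →
      Real.log z ^ k / z = (Real.log z / z ^ (1 / (k : ℝ))) ^ k := by
    intro z hz
    rw [div_pow, ← Real.rpow_natCast (z ^ (1 / (k : ℝ))), ← Real.rpow_mul hz.le,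
      one_div_mul_cancel hkR.ne', Real.rpow_one]
  have h0 := Real.log_div_self_rpow_antitoneOn (a := 1 / (k : ℝ)) (by positivity)
  have h := h0 (a := x) (by simpa using hx) (b := y) (by simpa using hy) hxy
  have hy1 : 1 ≤ y := (Real.one_le_exp hkR.le).trans hy
  change Real.log y ^ k / y ≤ Real.log x ^ k / x
  rw [key x hx0, key y hy0]
  exact pow_le_pow_left₀ (div_nonneg (Real.log_nonneg hy1) (Real.rpow_nonneg hy0.le _)) h k

theorem stieltjes_step (k n : ℕ) (hn : Real.exp k ≤ n) :
    Real.log (n + 1 : ℕ) ^ k / (n + 1 : ℕ) ≤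
      Real.log (n + 1 : ℕ) ^ (k + 1) / (k + 1) - Real.log n ^ (k + 1) / (k + 1) ∧
    Real.log (n + 1 : ℕ) ^ (k + 1) / (k + 1) - Real.log n ^ (k + 1) / (k + 1) ≤
      Real.log n ^ k / n := by
  have hn0 : (0 : ℝ) < n := (Real.exp_pos _).trans_le hn
  have hlt : (n : ℝ) < (n + 1 : ℕ) := by push_cast; linarith
  have hd : ∀ x : ℝ, 0 < x →
      HasDerivAt (fun x : ℝ => Real.log x ^ (k + 1) / (k + 1)) (Real.log x ^ k / x) x := by
    intro x hx
    have h := ((Real.hasDerivAt_log hx.ne').pow (k + 1)).div_const ((k : ℝ) + 1)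
    have hk : (k : ℝ) + 1 ≠ 0 := by positivity
    refine h.congr_deriv ?_
    rw [Nat.add_sub_cancel, Nat.cast_add, Nat.cast_one, div_eq_iff hk, div_eq_mul_inv]
    ring
  obtain ⟨c, hc, he⟩ := exists_hasDerivAt_eq_slope
    (fun x : ℝ => Real.log x ^ (k + 1) / (k + 1)) (fun x => Real.log x ^ k / x) hlt
    (fun x hx => (hd x (hn0.trans_le hx.1)).continuousAt.continuousWithinAt)
    (fun x hx => hd x (hn0.trans hx.1))
  have h1 : ((n + 1 : ℕ) : ℝ) - n = 1 := by push_cast; ring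
  rw [h1, div_one] at he
  rw [← he]
  have hc' : Real.exp k ≤ c := hn.trans hc.1.le
  exact ⟨stieltjes_antitone k hc' (hc'.trans hc.2.le) hc.2.le,
    stieltjes_antitone k hn hc' hc.1.le⟩

theorem tendsto_stieltjesSeq (k : ℕ) :
    Tendsto (stieltjesSeq k) atTop (𝓝 (stieltjesConst k)) := by
  obtain ⟨M, hM⟩ := exists_nat_ge (Real.exp k)
  have hM' : ∀ n : ℕ, Real.exp k ≤ (n + M : ℕ) := fun n => by
    push_cast
    linarith [Nat.cast_nonneg (α := ℝ) n]
  have hstep : ∀ n : ℕ, stieltjesSeq k (n + 1) = stieltjesSeq k n +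
      (Real.log (n + 1 : ℕ) ^ k / (n + 1 : ℕ) -
        (Real.log (n + 1 : ℕ) ^ (k + 1) / (k + 1) - Real.log n ^ (k + 1) / (k + 1))) := by
    intro n
    unfold stieltjesSeq
    rw [Finset.sum_Icc_succ_top (by omega)]
    ring
  have hanti : Antitone (fun n => stieltjesSeq k (n + M)) := by
    refine antitone_nat_of_succ_le fun n => ?_
    have h := (stieltjes_step k (n + M) (hM' n)).1
    have h2 := hstep (n + M)
    rw [show n + 1 + M = n + M + 1 by ring]
    linarith
  have hmono : Monotone (fun n : ℕ => stieltjesSeq k (n + M) -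
      Real.log (n + M : ℕ) ^ k / (n + M : ℕ)) := by
    refine monotone_nat_of_le_succ fun n => ?_
    have h := (stieltjes_step k (n + M) (hM' n)).2
    have h2 := hstep (n + M)
    rw [show n + 1 + M = n + M + 1 by ring]
    linarith
  have hbdd : BddBelow (Set.range fun n => stieltjesSeq k (n + M)) := by
    refine ⟨stieltjesSeq k (0 + M) - Real.log (0 + M : ℕ) ^ k / (0 + M : ℕ), ?_⟩
    rintro _ ⟨n, rfl⟩
    have h := hmono (Nat.zero_le n)
    have h2 : 0 ≤ Real.log (n + M : ℕ) ^ k / (n + M : ℕ) :=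
      div_nonneg (pow_nonneg (Real.log_natCast_nonneg _) _) (Nat.cast_nonneg _)
    simp only at h ⊢
    linarith
  have h := tendsto_atTop_ciInf hanti hbdd
  exact tendsto_nhds_limUnder ⟨_, (tendsto_add_atTop_iff_nat M).1 h⟩

/-- `ν(s) = ζ(s) ζ''(s) - ζ'(s)²`. -/
noncomputable def nu (s : ℂ) : ℂ :=
  riemannZeta s * deriv (deriv riemannZeta) s - deriv riemannZeta s ^ 2

/-- The coefficients `a(n) = ∑_{d ∣ n} (log² d - log d log (n/d))`. -/
noncomputable def nuCoeff (n : ℕ) : ℝ :=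
  ∑ d ∈ n.divisors, (Real.log d ^ 2 - Real.log d * Real.log ((n : ℝ) / d))

/-- The summatory function `A(x) = ∑_{n < x} a(n)`, over integers `1 ≤ n < x`. -/
noncomputable def nuSum (x : ℝ) : ℝ :=
  ∑ n ∈ Finset.Ico 1 ⌈x⌉₊, nuCoeff n

/-- The cubic polynomial `p(t)` of the main term. -/
noncomputable def mainPoly (t : ℝ) : ℝ :=
  t ^ 3 / 6 + (Real.eulerMascheroniConstant - 1 / 2) * t ^ 2 +
    (1 - 4 * stieltjesConst 1 - 2 * Real.eulerMascheroniConstant) * t +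
    4 * stieltjesConst 2 + 4 * stieltjesConst 1 + 2 * Real.eulerMascheroniConstant - 1

/-!
The coefficient `a(n)` symmetrises to `½ ∑_{de = n} (log d - log e)²`, so the summatory function
counts the lattice points `mn ≤ x` with the weight `½ (log m - log n)²`. This weight is symmetric and
vanishes on the diagonal, so Dirichlet's hyperbola method takes the simple form
`∑_{m ≤ √x} ∑_{m < n ≤ x/m} (log n - log m)²` (`sum_nuCoeff_eq`).

With `ψ(t) = {t} - 1/2` and `L = log (x/m²)`, Euler–Maclaurin summation turns the inner sum into
`(x/m)(L² - 2L + 2) - 2m - ψ(x/m) L²` up to `O((1 + log x)/m)` (`abs_sum_sq_log_sub_le`). Since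
`L² - 2L + 2` is a quadratic polynomial in `log m`, the sum of the first term over `m ≤ √x` is a
combination of the partial sums that define the Stieltjes constants
(`abs_sum_quadratic_log_div_sub_le`). Together with `-2 ∑ m` it gives `x p(log x)`: the two terms
`2√x ψ(√x)` cancel, and what is left is a power of `log x`.

The exponent `1/3` comes from `∑_{m ≤ M} ψ(x/m) ≪ x^{1/3} log² x` for `M ≤ √x`
(`abs_sum_sawtooth_le`), which is proved without exponential sums. On a dyadic range `[N, 2N)` let
`Q = ⌊N x^{-1/3}⌋`, and approximate the slope `x/n²` by a fraction `p/q` with `q ≤ Q` and error at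
most `1/(qQ)`. On the `q` integers that follow `n` the function `x/m` stays within `2/q` of a linear
function of slope `-p/q`, so its fractional parts are equidistributed modulo `1` and the block
contributes `O(1)` (`abs_sum_sawtooth_block_le`). Blocks with the same `p/q` start in an interval of
length `O(N³/(xqQ))` at distances at least `q`, and about `qx/N²` numerators occur for each `q`, so
there are `O(x^{1/3} log x)` blocks (`card_block_starts_le`). The weights `L²` decrease in `m` and are
removed by partial summation (`abs_sum_mul_le_of_antitone`).

The Dirichlet series identity is the convolution identity for `ζ`, `-ζ'` and `ζ''`
(`LSeriesHasSum_nuCoeff`). The strict inequality `n < x` in the summatory function is reached as a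
limit from the left (`abs_nuSum_sub_le`).
-/

/-! ### Sawtooth sums over blocks -/

/-- The sawtooth function `ψ(t) = {t} - 1/2`. -/
noncomputable def sawtooth (t : ℝ) : ℝ := Int.fract t - 1 / 2

theorem abs_sawtooth_le (t : ℝ) : |sawtooth t| ≤ 1 / 2 := by
  have h1 := Int.fract_nonneg t
  have h2 := Int.fract_lt_one t
  unfold sawtooth
  rw [abs_le]
  constructor <;> linarith

theorem sawtooth_eq (t : ℝ) : sawtooth t = t - ⌊t⌋ - 1 / 2 := rfl

theorem sum_emod_of_coprime {q : ℕ} (hq : 0 < q) {p : ℤ} (hp : IsCoprime (q : ℤ) p) (c : ℤ) :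
    ∑ j ∈ Finset.range q, (c - j * p) % (q : ℤ) = ∑ r ∈ Finset.range q, (r : ℤ) := by
  have hq' : (q : ℤ) ≠ 0 := by exact_mod_cast hq.ne'
  have hmaps : Set.MapsTo (fun j : ℕ => ((c - j * p) % (q : ℤ)).toNat)
      (Finset.range q : Set ℕ) (Finset.range q : Set ℕ) := by
    intro j _
    have h1 := Int.emod_nonneg (c - j * p) hq'
    have h2 := Int.emod_lt_of_pos (c - j * p) (b := (q : ℤ)) (by exact_mod_cast hq)
    simp only [Finset.coe_range, Set.mem_Iio]
    omega
  have hinj : Set.InjOn (fun j : ℕ => ((c - j * p) % (q : ℤ)).toNat)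
      (Finset.range q : Set ℕ) := by
    intro i hi j hj hij
    simp only [Finset.coe_range, Set.mem_Iio] at hi hj hij
    have h1 := Int.emod_nonneg (c - i * p) hq'
    have h2 := Int.emod_nonneg (c - j * p) hq'
    have h3 : (c - i * p) % (q : ℤ) = (c - j * p) % (q : ℤ) := by omega
    have h4 : (q : ℤ) ∣ ((j : ℤ) - i) * p := by
      have := Int.ModEq.dvd (show c - j * p ≡ c - i * p [ZMOD q] from h3.symm)
      convert this using 1
      ring
    have h5 := hp.dvd_of_dvd_mul_right h4
    have h6 := Int.eq_zero_of_abs_lt_dvd h5 (by rw [abs_lt]; omega)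
    omega
  refine Finset.sum_nbij (fun j : ℕ => ((c - j * p) % (q : ℤ)).toNat) hmaps hinj
    (Finset.surjOn_of_injOn_of_card_le _ hmaps hinj le_rfl) fun j _ => ?_
  exact (Int.toNat_of_nonneg (Int.emod_nonneg _ hq')).symm

/-- Hermite's identity along a complete system of residues. -/
theorem sum_ediv_of_coprime {q : ℕ} (hq : 0 < q) {p : ℤ} (hp : IsCoprime (q : ℤ) p) (c : ℤ) :
    ∑ j ∈ Finset.range q, (((c - j * p) / (q : ℤ) : ℤ) : ℝ) =
      ∑ j ∈ Finset.range q, ((c : ℝ) - j * p) / q - ((q : ℝ) - 1) / 2 := by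
  have hq' : (q : ℝ) ≠ 0 := by exact_mod_cast hq.ne'
  have h1 : ∀ j ∈ Finset.range q, (((c - j * p) / (q : ℤ) : ℤ) : ℝ) =
      ((c : ℝ) - j * p) / q - (((c - j * p) % (q : ℤ) : ℤ) : ℝ) / q := by
    intro j _
    have h := Int.mul_ediv_add_emod (c - j * p) q
    have h2 : (q : ℝ) * (((c - j * p) / (q : ℤ) : ℤ) : ℝ) +
        (((c - j * p) % (q : ℤ) : ℤ) : ℝ) = c - j * p := by exact_mod_cast h
    field_simp
    linarith
  rw [Finset.sum_congr rfl h1, Finset.sum_sub_distrib, ← Finset.sum_div (Finset.range q)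
    (fun j : ℕ => (((c - j * p) % (q : ℤ) : ℤ) : ℝ)) (q : ℝ), ← Int.cast_sum,
    sum_emod_of_coprime hq hp c]
  congr 1
  have h3 : (∑ r ∈ Finset.range q, (r : ℝ)) * 2 = q * (q - 1) := by
    have := Finset.sum_range_id_mul_two q
    have h4 : (((∑ i ∈ Finset.range q, i) * 2 : ℕ) : ℝ) = ((q * (q - 1) : ℕ) : ℝ) := by rw [this]
    rw [Nat.cast_mul, Nat.cast_mul, Nat.cast_sub hq] at h4
    push_cast at h4
    exact h4
  push_cast
  field_simp
  linarith

/-- Along a block of `q` consecutive integers on which the argument is within `2 / q` of a linear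
function of slope `-p / q` in lowest terms, the fractional parts are equidistributed up to `O(1)`,
so the sawtooth sum is bounded. -/
theorem abs_sum_sawtooth_block_le {q : ℕ} (hq : 0 < q) {p : ℤ} (hp : IsCoprime (q : ℤ) p)
    (β : ℝ) (u : ℕ → ℝ) (hu : ∀ j < q, |u j - (β - j * p / q)| ≤ 2 / q) :
    |∑ j ∈ Finset.range q, sawtooth (u j)| ≤ 6 := by
  have hq' : (0 : ℝ) < q := by exact_mod_cast hq
  set b : ℤ := ⌊q * β⌋ with hb
  have hb1 : (b : ℝ) ≤ q * β := Int.floor_le _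
  have hb2 : q * β < b + 1 := Int.lt_floor_add_one _
  -- Replacing `q * β` by its floor moves `q * u j` into `[b - 2 - j p, b + 3 - j p]`, and Hermite's
  -- identity evaluates the sum of the floors at both ends.
  have hlow : ∀ j < q, ((b : ℝ) - 2 - j * p) / q ≤ u j := by
    intro j hj
    have h := (abs_le.1 (hu j hj)).1
    have e : ((b : ℝ) - 2 - j * p) / q ≤ β - j * p / q - 2 / q := by
      rw [div_le_iff₀ hq']
      field_simp
      linarith
    linarith
  have hupp : ∀ j < q, u j ≤ ((b : ℝ) + 3 - j * p) / q := by
    intro j hj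
    have h := (abs_le.1 (hu j hj)).2
    have e : β - j * p / q + 2 / q ≤ ((b : ℝ) + 3 - j * p) / q := by
      rw [le_div_iff₀ hq']
      field_simp
      linarith
    linarith
  have hfl : ∀ (c : ℤ) (j : ℕ), ⌊((c : ℝ) - j * p) / q⌋ = (c - j * p) / (q : ℤ) := by
    intro c j
    have := Rat.floor_intCast_div_natCast (c - j * p) q
    rw [← Rat.floor_cast (α := ℝ)] at this
    push_cast at this
    exact this
  have hconst : ∑ _j ∈ Finset.range q, (5 : ℝ) / q = 5 := by
    rw [Finset.sum_const, Finset.card_range, nsmul_eq_mul]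
    field_simp
  have hhalf : ∑ _j ∈ Finset.range q, (1 / 2 : ℝ) = q / 2 := by
    rw [Finset.sum_const, Finset.card_range, nsmul_eq_mul]
    ring
  have e1 := sum_ediv_of_coprime hq hp (b - 2)
  have e2 := sum_ediv_of_coprime hq hp (b + 3)
  rw [abs_le]
  constructor
  · have h1 : ∑ j ∈ Finset.range q, (((b : ℝ) - 2 - j * p) / q -
        (((b + 3 - j * p) / (q : ℤ) : ℤ) : ℝ) - 1 / 2) ≤
        ∑ j ∈ Finset.range q, sawtooth (u j) := by
      refine Finset.sum_le_sum fun j hj => ?_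
      have hj' := Finset.mem_range.1 hj
      have h2 : ⌊u j⌋ ≤ (b + 3 - j * p) / (q : ℤ) := by
        rw [← hfl]
        refine Int.floor_le_floor ?_
        push_cast
        exact hupp j hj'
      have h3 : (⌊u j⌋ : ℝ) ≤ (((b + 3 - j * p) / (q : ℤ) : ℤ) : ℝ) := by exact_mod_cast h2
      rw [sawtooth_eq]
      linarith [hlow j hj']
    have h4 : ∑ j ∈ Finset.range q, ((b : ℝ) - 2 - j * p) / q =
        ∑ j ∈ Finset.range q, (((b + 3 : ℤ) : ℝ) - j * p) / q - 5 := by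
      rw [← hconst, ← Finset.sum_sub_distrib]
      refine Finset.sum_congr rfl fun j _ => ?_
      push_cast
      field_simp
      ring
    rw [Finset.sum_sub_distrib, Finset.sum_sub_distrib, hhalf, e2, h4] at h1
    linarith
  · have h1 : ∑ j ∈ Finset.range q, sawtooth (u j) ≤
        ∑ j ∈ Finset.range q, (((b : ℝ) + 3 - j * p) / q -
        (((b - 2 - j * p) / (q : ℤ) : ℤ) : ℝ) - 1 / 2) := by
      refine Finset.sum_le_sum fun j hj => ?_
      have hj' := Finset.mem_range.1 hj
      have h2 : (b - 2 - j * p) / (q : ℤ) ≤ ⌊u j⌋ := by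
        rw [← hfl]
        refine Int.floor_le_floor ?_
        push_cast
        exact hlow j hj'
      have h3 : (((b - 2 - j * p) / (q : ℤ) : ℤ) : ℝ) ≤ (⌊u j⌋ : ℝ) := by exact_mod_cast h2
      rw [sawtooth_eq]
      linarith [hupp j hj']
    have h4 : ∑ j ∈ Finset.range q, ((b : ℝ) + 3 - j * p) / q =
        ∑ j ∈ Finset.range q, (((b - 2 : ℤ) : ℝ) - j * p) / q + 5 := by
      rw [← hconst, ← Finset.sum_add_distrib]
      refine Finset.sum_congr rfl fun j _ => ?_
      push_cast
      field_simp
      ring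
    rw [Finset.sum_sub_distrib, Finset.sum_sub_distrib, hhalf, e1, h4] at h1
    linarith

/-- Greedy decomposition of `[a, b)` into blocks `[s, s + q s)` with small sums, up to one
incomplete block at the end. -/
theorem exists_block_starts (g : ℕ → ℝ) (q : ℕ → ℕ) (Q : ℕ) (B : ℝ) (b : ℕ)
    (hg : ∀ n, |g n| ≤ 1) (a : ℕ) (hq : ∀ n, a ≤ n → 0 < q n) (hqQ : ∀ n, a ≤ n → q n ≤ Q)
    (hB : ∀ n, a ≤ n → |∑ j ∈ Finset.range (q n), g (n + j)| ≤ B) :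
    ∃ S : Finset ℕ, S ⊆ Finset.Ico a b ∧ (∀ s ∈ S, ∀ t ∈ S, s < t → s + q s ≤ t) ∧
      |∑ n ∈ Finset.Ico a b, g n| ≤ B * S.card + Q := by
  induction hk : b - a using Nat.strong_induction_on generalizing a with
  | _ k ih =>
    by_cases h : a + q a ≤ b
    · have hqa := hq a le_rfl
      obtain ⟨S, hS, hsep, hsum⟩ := ih (b - (a + q a)) (by omega) (a + q a)
        (fun n hn => hq n (by omega)) (fun n hn => hqQ n (by omega))
        (fun n hn => hB n (by omega)) rfl
      have ha : a ∉ S := fun h' => by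
        have := Finset.mem_Ico.1 (hS h')
        omega
      refine ⟨insert a S, ?_, ?_, ?_⟩
      · intro s hs
        rcases Finset.mem_insert.1 hs with rfl | hs
        · exact Finset.mem_Ico.2 ⟨le_rfl, by omega⟩
        · have := Finset.mem_Ico.1 (hS hs)
          exact Finset.mem_Ico.2 ⟨by omega, this.2⟩
      · intro s hs t ht hst
        rcases Finset.mem_insert.1 hs with rfl | hs
        · rcases Finset.mem_insert.1 ht with rfl | ht
          · omega
          · exact (Finset.mem_Ico.1 (hS ht)).1
        · rcases Finset.mem_insert.1 ht with ht | ht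
          · have := Finset.mem_Ico.1 (hS hs)
            omega
          · exact hsep s hs t ht hst
      · rw [Finset.card_insert_of_notMem ha, ← Finset.sum_Ico_consecutive g (by omega) h]
        have h1 : |∑ n ∈ Finset.Ico a (a + q a), g n| ≤ B := by
          rw [Finset.sum_Ico_eq_sum_range, Nat.add_sub_cancel_left]
          exact hB a le_rfl
        push_cast
        linarith [abs_add_le (∑ n ∈ Finset.Ico a (a + q a), g n)
          (∑ n ∈ Finset.Ico (a + q a) b, g n)]
    · refine ⟨∅, by simp, by simp, ?_⟩
      have h1 : |∑ n ∈ Finset.Ico a b, g n| ≤ ∑ n ∈ Finset.Ico a b, (1 : ℝ) :=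
        (Finset.abs_sum_le_sum_abs _ _).trans (Finset.sum_le_sum fun n _ => hg n)
      have h2 : b - a ≤ Q := by have := hqQ a le_rfl; omega
      have h3 : ((b - a : ℕ) : ℝ) ≤ Q := by exact_mod_cast h2
      simp only [Finset.sum_const, Nat.card_Ico, nsmul_eq_mul, mul_one] at h1
      simp only [Finset.card_empty, Nat.cast_zero, mul_zero, zero_add]
      linarith

theorem card_le_of_separated (T : Finset ℕ) {q : ℕ} (hq : 0 < q) {D : ℝ} (hD : 0 ≤ D)
    (hsep : ∀ s ∈ T, ∀ t ∈ T, s < t → s + q ≤ t)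
    (hdiam : ∀ s ∈ T, ∀ t ∈ T, s ≤ t → (t : ℝ) - s ≤ D) : (T.card : ℝ) ≤ D / q + 1 := by
  have hq' : (0 : ℝ) < q := by exact_mod_cast hq
  rcases T.eq_empty_or_nonempty with rfl | hT
  · simp only [Finset.card_empty, Nat.cast_zero]
    positivity
  set m := T.min' hT
  have hm : m ∈ T := T.min'_mem hT
  have hml : ∀ s ∈ T, m ≤ s := fun s hs => T.min'_le s hs
  have hcard : T.card ≤ (Finset.range (⌊D / q⌋₊ + 1)).card := by
    refine Finset.card_le_card_of_injOn (fun s => (s - m) / q) ?_ ?_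
    · intro s hs
      have hs' : s ∈ T := hs
      simp only [Finset.coe_range, Set.mem_Iio, Nat.lt_succ_iff]
      refine Nat.le_floor ?_
      rw [le_div_iff₀ hq']
      have h1 : (s - m) / q * q ≤ s - m := Nat.div_mul_le_self _ _
      have h2 : (((s - m) / q * q : ℕ) : ℝ) ≤ ((s - m : ℕ) : ℝ) := by exact_mod_cast h1
      rw [Nat.cast_sub (hml s hs')] at h2
      push_cast at h2 ⊢
      exact h2.trans (hdiam m hm s hs' (hml s hs'))
    · have key : ∀ s ∈ T, ∀ t ∈ T, s < t → (s - m) / q < (t - m) / q := by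
        intro s hs t ht hst
        have h1 := hsep s hs t ht hst
        have h2 := hml s hs
        calc (s - m) / q < (s - m) / q + 1 := Nat.lt_succ_self _
          _ = (s - m + q) / q := (Nat.add_div_right _ hq).symm
          _ ≤ (t - m) / q := Nat.div_le_div_right (by omega)
      intro s hs t ht hst
      have hst' : (s - m) / q = (t - m) / q := hst
      rcases lt_trichotomy s t with h | h | h
      · exact absurd hst' (key s hs t ht h).ne
      · exact h
      · exact absurd hst' (key t ht s hs h).ne'
  rw [Finset.card_range] at hcard
  have h3 : (T.card : ℝ) ≤ ⌊D / q⌋₊ + 1 := by exact_mod_cast hcard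
  linarith [Nat.floor_le (show (0 : ℝ) ≤ D / q by positivity)]

/-! ### Sawtooth sums of `x / n` -/

/-- Near `n` the function `x / (n + j)` is linear in `j` up to `q² x / N³`, which is at most `1 / q`
for `q ≤ Q` since `Q³ x ≤ N³`. -/
theorem abs_sum_sawtooth_div_block_le {x : ℝ} (hx : 0 < x) {N n Q : ℕ} (hN : 0 < N) (hn : N ≤ n)
    (hQ : (Q : ℝ) ^ 3 * x ≤ (N : ℝ) ^ 3) {r : ℚ}
    (hr : |x / (n : ℝ) ^ 2 - r| ≤ 1 / ((Q + 1) * r.den)) (hrQ : r.den ≤ Q) :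
    |∑ j ∈ Finset.range r.den, sawtooth (x / ((n + j : ℕ) : ℝ))| ≤ 6 := by
  have hq : 0 < r.den := r.den_pos
  have hq' : (0 : ℝ) < r.den := by exact_mod_cast hq
  have hN' : (0 : ℝ) < N := by exact_mod_cast hN
  have hn' : (N : ℝ) ≤ n := by exact_mod_cast hn
  have hn0 : (0 : ℝ) < n := hN'.trans_le hn'
  have hrQ' : (r.den : ℝ) ≤ Q := by exact_mod_cast hrQ
  have hcop : IsCoprime (r.den : ℤ) r.num := (Rat.isCoprime_num_den r).symm
  refine abs_sum_sawtooth_block_le hq hcop (x / n) _ fun j hj => ?_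
  have hj' : (j : ℝ) ≤ r.den := by exact_mod_cast hj.le
  have hj0 : (0 : ℝ) ≤ j := Nat.cast_nonneg j
  have hr' : (r : ℝ) = r.num / r.den := Rat.cast_def r
  have e : x / ((n + j : ℕ) : ℝ) - (x / n - j * r.num / r.den) =
      -(j * (x / (n : ℝ) ^ 2 - r)) + (j : ℝ) ^ 2 * x / ((n : ℝ) ^ 2 * (n + j)) := by
    rw [hr']
    push_cast
    have : (n : ℝ) + j ≠ 0 := by positivity
    field_simp
    ring
  have h1 : |(j : ℝ) * (x / (n : ℝ) ^ 2 - r)| ≤ 1 / r.den := by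
    rw [abs_mul, abs_of_nonneg hj0]
    calc (j : ℝ) * |x / (n : ℝ) ^ 2 - r| ≤ (Q + 1) * (1 / ((Q + 1) * r.den)) := by
          refine mul_le_mul (by linarith) hr (abs_nonneg _) (by positivity)
      _ = 1 / r.den := by field_simp
  have h2 : (j : ℝ) ^ 2 * x / ((n : ℝ) ^ 2 * (n + j)) ≤ 1 / r.den := by
    rw [div_le_div_iff₀ (by positivity) hq', one_mul]
    calc (j : ℝ) ^ 2 * x * r.den ≤ (r.den : ℝ) ^ 2 * x * r.den := by gcongr
      _ = (r.den : ℝ) ^ 3 * x := by ring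
      _ ≤ (Q : ℝ) ^ 3 * x := by gcongr
      _ ≤ (N : ℝ) ^ 3 := hQ
      _ ≤ (n : ℝ) ^ 3 := by gcongr
      _ = (n : ℝ) ^ 2 * (n + 0) := by ring
      _ ≤ (n : ℝ) ^ 2 * (n + j) := by gcongr
  have h3 : 0 ≤ (j : ℝ) ^ 2 * x / ((n : ℝ) ^ 2 * (n + j)) := by positivity
  rw [e]
  calc _ ≤ |-((j : ℝ) * (x / (n : ℝ) ^ 2 - r))| +
        |(j : ℝ) ^ 2 * x / ((n : ℝ) ^ 2 * (n + j))| := abs_add_le _ _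
    _ ≤ 1 / r.den + 1 / r.den := by
        rw [abs_neg, abs_of_nonneg h3]
        exact add_le_add h1 h2
    _ = 2 / r.den := by ring

/-- The points of `[N, 2N)` where the slope `x / n²` is close to a fixed fraction of denominator `q`
lie in an interval of length `16 N³ / (x q Q)`. -/
theorem sub_le_of_slope_near {x : ℝ} (hx : 0 < x) {N Q q s t : ℕ} (hN : 0 < N) (hQ : 0 < Q)
    (hq : 0 < q) (hs : N ≤ s) (hst : s ≤ t) (ht : t ≤ 2 * N) {ρ : ℝ}
    (h1 : |x / (s : ℝ) ^ 2 - ρ| ≤ 1 / ((Q + 1) * q))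
    (h2 : |x / (t : ℝ) ^ 2 - ρ| ≤ 1 / ((Q + 1) * q)) :
    (t : ℝ) - s ≤ 16 * (N : ℝ) ^ 3 / (x * q * Q) := by
  have hN' : (0 : ℝ) < N := by exact_mod_cast hN
  have hQ' : (0 : ℝ) < Q := by exact_mod_cast hQ
  have hq' : (0 : ℝ) < q := by exact_mod_cast hq
  have hs' : (N : ℝ) ≤ s := by exact_mod_cast hs
  have hst' : (s : ℝ) ≤ t := by exact_mod_cast hst
  have ht' : (t : ℝ) ≤ 2 * N := by exact_mod_cast ht
  have hs0 : (0 : ℝ) < s := hN'.trans_le hs'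
  have ht0 : (0 : ℝ) < t := hs0.trans_le hst'
  have h3 : x / (s : ℝ) ^ 2 - x / (t : ℝ) ^ 2 ≤ 2 / (q * Q) := by
    have e : 1 / (((Q : ℝ) + 1) * q) ≤ 1 / (q * Q) := by
      refine one_div_le_one_div_of_le (by positivity) ?_
      nlinarith
    have e2 : 2 / ((q : ℝ) * Q) = 1 / (q * Q) + 1 / (q * Q) := by ring
    linarith [(abs_le.1 h1).2, (abs_le.1 h2).1]
  have h4 : ((t : ℝ) - s) * (x / (8 * (N : ℝ) ^ 3)) ≤ x / (s : ℝ) ^ 2 - x / (t : ℝ) ^ 2 := by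
    have e : x / (s : ℝ) ^ 2 - x / (t : ℝ) ^ 2 =
        ((t : ℝ) - s) * (x * ((s + t) / ((s : ℝ) ^ 2 * t ^ 2))) := by
      field_simp
      ring
    rw [e]
    refine mul_le_mul_of_nonneg_left ?_ (by linarith)
    rw [div_eq_mul_one_div]
    refine mul_le_mul_of_nonneg_left ?_ hx.le
    rw [div_le_div_iff₀ (by positivity) (by positivity), one_mul]
    calc (s : ℝ) ^ 2 * t ^ 2 = (s : ℝ) * ((s : ℝ) * (t : ℝ) ^ 2) := by ring
      _ ≤ (s : ℝ) * ((2 * (N : ℝ)) * (2 * (N : ℝ)) ^ 2) := by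
          have : (s : ℝ) ≤ 2 * N := hst'.trans ht'
          gcongr
      _ = ((s : ℝ) + 0) * (8 * (N : ℝ) ^ 3) := by ring
      _ ≤ ((s : ℝ) + t) * (8 * (N : ℝ) ^ 3) := by gcongr
  have h5 := h4.trans h3
  rw [le_div_iff₀ (by positivity)]
  rw [le_div_iff₀ (by positivity), ← mul_div_assoc, div_mul_eq_mul_div,
    div_le_iff₀ (by positivity)] at h5
  linarith

/-- Counting blocks according to the fraction `r s` that approximates the slope at their start `s`:
for each denominator `q` there are at most `q x / N² + 2` numerators, and for each fraction the
starts are `q`-separated points of a short interval. -/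
theorem card_block_starts_le {x : ℝ} {N M Q : ℕ} (hN : 0 < N) (hM : M ≤ 2 * N)
    (hNx : (N : ℝ) ^ 2 ≤ x) (hQ : 0 < Q) (r : ℕ → ℚ)
    (hr : ∀ n : ℕ, |x / (n : ℝ) ^ 2 - r n| ≤ 1 / ((Q + 1) * (r n).den)) (hrQ : ∀ n, (r n).den ≤ Q)
    (S : Finset ℕ) (hS : S ⊆ Finset.Ico N M)
    (hsep : ∀ s ∈ S, ∀ t ∈ S, s < t → s + (r s).den ≤ t) :
    (S.card : ℝ) ≤ 48 * N / Q * (1 + Real.log Q) + 3 * x * Q ^ 2 / N ^ 2 := by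
  have hN' : (0 : ℝ) < N := by exact_mod_cast hN
  have hQ' : (0 : ℝ) < Q := by exact_mod_cast hQ
  have hx : 0 < x := lt_of_lt_of_le (by positivity) hNx
  set P : ℕ → ℕ := fun q => ⌊q * x / (N : ℝ) ^ 2⌋₊ + 2 with hP
  have hmaps : ∀ s ∈ S, (⟨(r s).den, (r s).num.toNat⟩ : Σ _ : ℕ, ℕ) ∈
      (Finset.Icc 1 Q).sigma (fun q => Finset.range (P q)) := by
    intro s hs
    have hs1 := Finset.mem_Ico.1 (hS hs)
    have hs' : (N : ℝ) ≤ s := by exact_mod_cast hs1.1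
    have hs0 : (0 : ℝ) < s := hN'.trans_le hs'
    have hd : (0 : ℝ) < (r s).den := by exact_mod_cast (r s).den_pos
    refine Finset.mem_sigma.2 ⟨Finset.mem_Icc.2 ⟨(r s).den_pos, hrQ s⟩, ?_⟩
    simp only [Finset.mem_range, hP]
    have h1 := (abs_le.1 (hr s)).1
    rw [Rat.cast_def] at h1
    have h2 : ((r s).num : ℝ) ≤ (r s).den * x / (N : ℝ) ^ 2 + 1 := by
      have e : x / (s : ℝ) ^ 2 ≤ x / (N : ℝ) ^ 2 := by gcongr
      have e2 : 1 / (((Q : ℝ) + 1) * (r s).den) ≤ 1 / (r s).den := by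
        refine one_div_le_one_div_of_le hd ?_
        nlinarith
      have h3 : ((r s).num : ℝ) / (r s).den ≤ x / (N : ℝ) ^ 2 + 1 / (r s).den := by linarith
      rw [div_le_iff₀ hd] at h3
      have e3 : (x / (N : ℝ) ^ 2 + 1 / (r s).den) * (r s).den =
        (r s).den * x / (N : ℝ) ^ 2 + 1 := by field_simp
      linarith
    have h4 : (r s).num.toNat ≤ ⌊(r s).den * x / (N : ℝ) ^ 2 + 1⌋₊ := by
      refine Nat.le_floor ?_
      rcases le_or_gt 0 (r s).num with h | h
      · have : (((r s).num.toNat : ℤ) : ℝ) = (r s).num := by rw [Int.toNat_of_nonneg h]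
        rw [Int.cast_natCast] at this
        rw [this]
        exact h2
      · rw [Int.toNat_of_nonpos h.le, Nat.cast_zero]
        positivity
    rw [Nat.floor_add_one (by positivity)] at h4
    omega
  have hfib : ∀ i ∈ (Finset.Icc 1 Q).sigma (fun q => Finset.range (P q)),
      ((S.filter (fun s => (⟨(r s).den, (r s).num.toNat⟩ : Σ _ : ℕ, ℕ) = i)).card : ℝ) ≤
        16 * (N : ℝ) ^ 3 / (x * i.1 * Q) / i.1 + 1 := by
    rintro ⟨q, p⟩ hi
    have hq : 0 < q := (Finset.mem_Icc.1 (Finset.mem_sigma.1 hi).1).1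
    have hq' : (0 : ℝ) < q := by exact_mod_cast hq
    have hnum : ∀ s ∈ S, 0 ≤ (r s).num := by
      intro s hs
      have hd : (0 : ℝ) < (r s).den := by exact_mod_cast (r s).den_pos
      have hs1 := Finset.mem_Ico.1 (hS hs)
      have hs0 : (0 : ℝ) < s := by exact_mod_cast hN.trans_le hs1.1
      have h1 := (abs_le.1 (hr s)).2
      rw [Rat.cast_def] at h1
      have h2 : 0 < x / (s : ℝ) ^ 2 := by positivity
      have e2 : 1 / (((Q : ℝ) + 1) * (r s).den) < 1 / (r s).den := by
        refine one_div_lt_one_div_of_lt hd ?_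
        nlinarith
      have h3 : -(1 / (r s).den) < ((r s).num : ℝ) / (r s).den := by linarith
      rw [lt_div_iff₀ hd] at h3
      have h4 : (-1 : ℝ) < (r s).num := by
        have : -(1 / ((r s).den : ℝ)) * (r s).den = -1 := by field_simp
        linarith
      have h5 : (-1 : ℤ) < (r s).num := by exact_mod_cast h4
      omega
    refine card_le_of_separated _ hq (by positivity) ?_ ?_
    · intro s hs t ht hst
      rw [Finset.mem_filter, Sigma.mk.injEq] at hs ht
      have := hsep s hs.1 t ht.1 hst
      rw [hs.2.1] at this
      exact this
    · intro s hs t ht hst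
      rw [Finset.mem_filter, Sigma.mk.injEq, heq_eq_eq] at hs ht
      have hs1 := Finset.mem_Ico.1 (hS hs.1)
      have ht1 := Finset.mem_Ico.1 (hS ht.1)
      have hrr : r s = r t := by
        refine Rat.ext ?_ (hs.2.1.trans ht.2.1.symm)
        have := hnum s hs.1
        have := hnum t ht.1
        omega
      have h1 := hr s
      have h2 := hr t
      rw [← hrr] at h2
      rw [hs.2.1] at h1 h2
      exact sub_le_of_slope_near hx hN hQ hq hs1.1 hst (by omega) h1 h2
  have hsum : (S.card : ℝ) ≤ ∑ q ∈ Finset.Icc 1 Q, (P q : ℝ) *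
      (16 * (N : ℝ) ^ 3 / (x * q * Q) / q + 1) := by
    rw [Finset.card_eq_sum_card_fiberwise hmaps, Nat.cast_sum]
    refine (Finset.sum_le_sum hfib).trans_eq ?_
    rw [Finset.sum_sigma]
    refine Finset.sum_congr rfl fun q _ => ?_
    dsimp only
    rw [Finset.sum_const, Finset.card_range, nsmul_eq_mul]
  have hterm : ∀ q ∈ Finset.Icc 1 Q, (P q : ℝ) *
      (16 * (N : ℝ) ^ 3 / (x * q * Q) / q + 1) ≤
      48 * N / Q * (q : ℝ)⁻¹ + 3 * x * Q / N ^ 2 := by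
    intro q hq
    have hq1 := Finset.mem_Icc.1 hq
    have hq1' : (1 : ℝ) ≤ q := by exact_mod_cast hq1.1
    have hqQ : (q : ℝ) ≤ Q := by exact_mod_cast hq1.2
    have hq' : (0 : ℝ) < q := by linarith
    have h1 : (1 : ℝ) ≤ q * x / (N : ℝ) ^ 2 := by
      rw [le_div_iff₀ (by positivity), one_mul]
      nlinarith
    have h2 : (P q : ℝ) ≤ 3 * (q * x / (N : ℝ) ^ 2) := by
      have := Nat.floor_le (show 0 ≤ q * x / (N : ℝ) ^ 2 by positivity)
      simp only [hP]
      push_cast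
      linarith
    calc _ ≤ 3 * (q * x / (N : ℝ) ^ 2) * (16 * (N : ℝ) ^ 3 / (x * q * Q) / q + 1) := by gcongr
      _ = 48 * N / Q * (q : ℝ)⁻¹ + 3 * x * q / N ^ 2 := by
        field_simp
        ring
      _ ≤ _ := by gcongr
  refine hsum.trans ((Finset.sum_le_sum hterm).trans ?_)
  rw [Finset.sum_add_distrib, ← Finset.mul_sum, Finset.sum_const, Nat.card_Icc,
    Nat.add_sub_cancel, nsmul_eq_mul]
  have hharm : ∑ q ∈ Finset.Icc 1 Q, (q : ℝ)⁻¹ ≤ 1 + Real.log Q := by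
    have := harmonic_le_one_add_log Q
    rw [harmonic_eq_sum_Icc] at this
    push_cast at this
    exact this
  have e : (Q : ℝ) * (3 * x * Q / N ^ 2) = 3 * x * Q ^ 2 / N ^ 2 := by ring
  rw [e]
  gcongr

/-- The dyadic sawtooth sums of `x / n` are `O(x^{1/3} log x)`; here `c = x^{1/3}`. -/
theorem abs_sum_sawtooth_dyadic_le {x c : ℝ} (hc : 1 ≤ c) (hcx : c ^ 3 = x) {N M : ℕ} (hN : 0 < N)
    (hNM : N ≤ M) (hM : M ≤ 2 * N) (hNx : (N : ℝ) ^ 2 ≤ x) :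
    |∑ n ∈ Finset.Ico N M, sawtooth (x / n)| ≤ 600 * c * (1 + Real.log x) := by
  have hN' : (1 : ℝ) ≤ N := by exact_mod_cast hN
  have hc0 : 0 < c := by linarith
  have hx1 : 1 ≤ x := by rw [← hcx]; exact one_le_pow₀ hc
  have hx : 0 < x := by linarith
  have hlx : 0 ≤ Real.log x := Real.log_nonneg hx1
  have hcl : 0 ≤ c * Real.log x := by positivity
  rcases lt_or_ge (N : ℝ) c with h | h
  -- Short sums are estimated trivially.
  · have h1 : |∑ n ∈ Finset.Ico N M, sawtooth (x / n)| ≤ ∑ n ∈ Finset.Ico N M, (1 / 2 : ℝ) :=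
      (Finset.abs_sum_le_sum_abs _ _).trans (Finset.sum_le_sum fun n _ => abs_sawtooth_le _)
    rw [Finset.sum_const, Nat.card_Ico, nsmul_eq_mul, Nat.cast_sub hNM] at h1
    have h2 : (M : ℝ) ≤ 2 * N := by exact_mod_cast hM
    linarith
  -- The largest `Q` for which the second-order error `q² x / N³` stays below `1 / q` for `q ≤ Q`.
  · set Q : ℕ := ⌊(N : ℝ) / c⌋₊ with hQdef
    have h1 : 1 ≤ (N : ℝ) / c := by rwa [le_div_iff₀ hc0, one_mul]
    have hQ : 0 < Q := Nat.floor_pos.2 h1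
    have hQ' : (1 : ℝ) ≤ Q := by exact_mod_cast hQ
    have hQle : (Q : ℝ) ≤ N / c := Nat.floor_le (by positivity)
    have hQge : (N : ℝ) / c ≤ 2 * Q := by
      have := Nat.lt_floor_add_one ((N : ℝ) / c)
      rw [← hQdef] at this
      linarith
    have hQ3 : (Q : ℝ) ^ 3 * x ≤ (N : ℝ) ^ 3 := by
      calc (Q : ℝ) ^ 3 * x ≤ ((N : ℝ) / c) ^ 3 * x := by gcongr
        _ = (N : ℝ) ^ 3 := by
          rw [← hcx]
          field_simp
    have hdir : ∀ n : ℕ, ∃ r : ℚ, |x / (n : ℝ) ^ 2 - r| ≤ 1 / ((Q + 1) * r.den) ∧ r.den ≤ Q :=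
      fun n => Real.exists_rat_abs_sub_le_and_den_le _ hQ
    choose r hr hrQ using hdir
    obtain ⟨S, hS, hsep, hsum⟩ := exists_block_starts (fun n => sawtooth (x / n))
      (fun n => (r n).den) Q 6 M (fun n => (abs_sawtooth_le _).trans (by norm_num)) N
      (fun n _ => (r n).den_pos) (fun n _ => hrQ n)
      (fun n hn => abs_sum_sawtooth_div_block_le hx hN hn hQ3 (hr n) (hrQ n))
    have hcard := card_block_starts_le hN hM hNx hQ r hr hrQ S hS hsep
    have e1 : 48 * (N : ℝ) / Q * (1 + Real.log Q) ≤ 96 * c * (1 + Real.log x) := by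
      have e2 : 48 * (N : ℝ) / Q ≤ 96 * c := by
        rw [div_le_iff₀ (by linarith)]
        rw [div_le_iff₀ hc0] at hQge
        linarith
      have e3 : Real.log Q ≤ Real.log x := by
        refine Real.log_le_log (by linarith) ?_
        calc (Q : ℝ) ≤ N / c := hQle
          _ ≤ N := div_le_self (by linarith) hc
          _ ≤ (N : ℝ) ^ 2 := by nlinarith
          _ ≤ x := hNx
      have e4 : 0 ≤ Real.log Q := Real.log_nonneg hQ'
      gcongr
    have e2 : 3 * x * (Q : ℝ) ^ 2 / (N : ℝ) ^ 2 ≤ 3 * c := by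
      calc 3 * x * (Q : ℝ) ^ 2 / (N : ℝ) ^ 2 ≤ 3 * x * (N / c) ^ 2 / (N : ℝ) ^ 2 := by gcongr
        _ = 3 * c := by
          rw [← hcx]
          field_simp
    have e3 : (Q : ℝ) ≤ c := by
      calc (Q : ℝ) ≤ N / c := hQle
        _ ≤ (N / c) ^ 2 := by nlinarith
        _ = (N : ℝ) ^ 2 / c ^ 2 := by rw [div_pow]
        _ ≤ c ^ 3 / c ^ 2 := by rw [hcx]; gcongr
        _ = c := by field_simp
    linarith

theorem abs_sum_sawtooth_Ico_le {x c : ℝ} (hc : 1 ≤ c) (hcx : c ^ 3 = x) (K : ℕ) :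
    ∀ M : ℕ, M ≤ 2 ^ K → ((M - 1 : ℕ) : ℝ) ^ 2 ≤ x →
      |∑ n ∈ Finset.Ico 1 M, sawtooth (x / n)| ≤ K * (600 * c * (1 + Real.log x)) := by
  induction K with
  | zero =>
    intro M hM _
    rw [Finset.Ico_eq_empty (by simp at hM ⊢; omega)]
    simp
  | succ K ih =>
    intro M hM hMx
    rcases Nat.lt_or_ge M 2 with h | h
    · have hx1 : 1 ≤ x := by rw [← hcx]; exact one_le_pow₀ hc
      have := Real.log_nonneg hx1
      rw [Finset.Ico_eq_empty (by omega)]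
      simp only [Finset.sum_empty, abs_zero]
      positivity
    · rw [← Finset.sum_Ico_consecutive _ (show 1 ≤ (M + 1) / 2 by omega)
        (show (M + 1) / 2 ≤ M by omega)]
      have hsq : (((M + 1) / 2 : ℕ) : ℝ) ^ 2 ≤ x := by
        refine le_trans ?_ hMx
        have : (((M + 1) / 2 : ℕ) : ℝ) ≤ ((M - 1 : ℕ) : ℝ) := by
          exact_mod_cast (by omega : (M + 1) / 2 ≤ M - 1)
        gcongr
      have h1 := ih ((M + 1) / 2) (by rw [pow_succ] at hM; omega) (by
        refine le_trans ?_ hsq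
        have : (((M + 1) / 2 - 1 : ℕ) : ℝ) ≤ (((M + 1) / 2 : ℕ) : ℝ) := by
          exact_mod_cast Nat.sub_le _ _
        gcongr)
      have h2 := abs_sum_sawtooth_dyadic_le hc hcx (show 0 < (M + 1) / 2 by omega)
        (show (M + 1) / 2 ≤ M by omega) (by omega) hsq
      push_cast
      linarith [abs_add_le (∑ n ∈ Finset.Ico 1 ((M + 1) / 2), sawtooth (x / n))
        (∑ n ∈ Finset.Ico ((M + 1) / 2) M, sawtooth (x / n))]

/-- Voronoi's exponent `1/3` for the sawtooth sum of the hyperbola method; here `c = x^{1/3}`. -/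
theorem abs_sum_sawtooth_le {x c : ℝ} (hc : 1 ≤ c) (hcx : c ^ 3 = x) {M : ℕ}
    (hM : (M : ℝ) ^ 2 ≤ x) :
    |∑ n ∈ Finset.Icc 1 M, sawtooth (x / n)| ≤ 1800 * c * (1 + Real.log x) ^ 2 := by
  have hx1 : 1 ≤ x := by rw [← hcx]; exact one_le_pow₀ hc
  have hlx := Real.log_nonneg hx1
  have h1 := abs_sum_sawtooth_Ico_le hc hcx (Nat.log 2 (M + 1) + 1) (M + 1)
    (Nat.lt_pow_succ_log_self (by norm_num) _).le (by simpa using hM)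
  have h2 : (Nat.log 2 (M + 1) : ℝ) ≤ 2 + 2 * Real.log x := by
    have h3 : (2 : ℝ) ^ Nat.log 2 (M + 1) ≤ 2 * x := by
      have h4 : 2 ^ Nat.log 2 (M + 1) ≤ M + 1 := Nat.pow_log_le_self 2 (by omega)
      have h5 : (2 : ℝ) ^ Nat.log 2 (M + 1) ≤ M + 1 := by exact_mod_cast h4
      nlinarith [sq_nonneg ((M : ℝ) - 1)]
    have h4 := Real.log_le_log (by positivity) h3
    rw [Real.log_pow, Real.log_mul (by norm_num) (by linarith)] at h4
    have h5 := Real.log_two_gt_d9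
    have h6 := Real.log_two_lt_d9
    nlinarith [Nat.cast_nonneg (α := ℝ) (Nat.log 2 (M + 1))]
  rw [show Finset.Icc 1 M = Finset.Ico 1 (M + 1) from rfl]
  refine h1.trans ?_
  push_cast
  have h7 : 0 ≤ 600 * c * (1 + Real.log x) := by positivity
  calc _ ≤ (3 * (1 + Real.log x)) * (600 * c * (1 + Real.log x)) := by
        refine mul_le_mul_of_nonneg_right ?_ h7
        linarith
    _ = _ := by ring

/-! ### The coefficients and their Dirichlet series -/

theorem nuCoeff_eq_half_sum_sq (n : ℕ) :
    nuCoeff n = ∑ d ∈ n.divisorsAntidiagonal, (Real.log d.1 - Real.log d.2) ^ 2 / 2 := by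
  have h1 : nuCoeff n = ∑ d ∈ n.divisorsAntidiagonal,
      (Real.log d.1 ^ 2 - Real.log d.1 * Real.log d.2) := by
    rw [nuCoeff, Nat.sum_divisorsAntidiagonal
      (fun a b : ℕ => Real.log a ^ 2 - Real.log a * Real.log b)]
    refine Finset.sum_congr rfl fun d hd => ?_
    have hd' := Nat.mem_divisors.1 hd
    have hd0 : (d : ℝ) ≠ 0 := by
      exact_mod_cast (Nat.pos_of_mem_divisors hd).ne'
    rw [Nat.cast_div hd'.1 hd0]
  have h2 : nuCoeff n = ∑ d ∈ n.divisorsAntidiagonal,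
      (Real.log d.2 ^ 2 - Real.log d.2 * Real.log d.1) := by
    rw [h1]
    nth_rewrite 1 [← Nat.map_swap_divisorsAntidiagonal]
    rw [Finset.sum_map]
    rfl
  have h3 : nuCoeff n = (nuCoeff n + nuCoeff n) / 2 := by ring
  rw [h3]
  nth_rewrite 1 [h1]
  rw [h2, ← Finset.sum_add_distrib, Finset.sum_div]
  refine Finset.sum_congr rfl fun d _ => ?_
  ring

open LSeries LSeries.notation in
theorem LSeriesHasSum_nuCoeff {s : ℂ} (hs : 1 < s.re) :
    LSeriesHasSum (fun n => (nuCoeff n : ℂ)) s (nu s) := by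
  have habs : ∀ {z : ℂ}, 1 < z.re → abscissaOfAbsConv 1 < z.re := by
    intro z hz
    rw [LSeries.abscissaOfAbsConv_one]
    exact_mod_cast hz
  have hopen : IsOpen {z : ℂ | 1 < z.re} := isOpen_lt continuous_const Complex.continuous_re
  have hderiv : ∀ {z : ℂ}, 1 < z.re → deriv riemannZeta z = -LSeries (logMul 1) z := by
    intro z hz
    rw [← LSeries_deriv (habs hz)]
    refine Filter.EventuallyEq.deriv_eq ?_
    filter_upwards [hopen.mem_nhds hz] with w hw
    exact (LSeries_one_eq_riemannZeta hw).symm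
  have hderiv2 : deriv (deriv riemannZeta) s = LSeries (logMul (logMul 1)) s := by
    have h1 : deriv (deriv riemannZeta) s = deriv (fun z => -LSeries (logMul 1) z) s := by
      refine Filter.EventuallyEq.deriv_eq ?_
      filter_upwards [hopen.mem_nhds hs] with w hw
      exact hderiv hw
    rw [h1, deriv.fun_neg, LSeries_deriv (by rw [abscissaOfAbsConv_logMul]; exact habs hs),
      neg_neg]
  have s0 : LSeriesHasSum 1 s (riemannZeta s) := LSeriesHasSum_one hs
  have s1 : LSeriesHasSum (logMul 1) s (-deriv riemannZeta s) := by
    rw [hderiv hs, neg_neg]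
    exact (LSeriesSummable_logMul_of_lt_re (habs hs)).LSeriesHasSum
  have s2 : LSeriesHasSum (logMul (logMul 1)) s (deriv (deriv riemannZeta) s) := by
    rw [hderiv2]
    exact (LSeriesSummable_logMul_of_lt_re
      (by rw [abscissaOfAbsConv_logMul]; exact habs hs)).LSeriesHasSum
  have hmain := (s2.convolution s0).sub (s1.convolution s1)
  have e : nu s = deriv (deriv riemannZeta) s * riemannZeta s -
      -deriv riemannZeta s * -deriv riemannZeta s := by
    rw [nu]
    ring
  rw [e]
  convert hmain using 1
  ext n
  rw [Pi.sub_apply, LSeries.convolution_def, LSeries.convolution_def, nuCoeff]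
  beta_reduce
  rw [Nat.sum_divisorsAntidiagonal
      (fun a b : ℕ => logMul (logMul (1 : ℕ → ℂ)) a * (1 : ℕ → ℂ) b),
    Nat.sum_divisorsAntidiagonal (fun a b : ℕ => logMul (1 : ℕ → ℂ) a * logMul (1 : ℕ → ℂ) b),
    ← Finset.sum_sub_distrib, Complex.ofReal_sum]
  refine Finset.sum_congr rfl fun d hd => ?_
  have hd' := Nat.mem_divisors.1 hd
  have hd0 : (d : ℝ) ≠ 0 := by
    exact_mod_cast (Nat.pos_of_mem_divisors hd).ne'
  rw [← Nat.cast_div hd'.1 hd0]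
  simp only [logMul, Pi.one_apply, mul_one]
  push_cast
  ring

/-- Dirichlet's hyperbola method. The summand `(log m - log n)²` is symmetric and vanishes on the
diagonal, so only the pairs `m < n` remain, and there is no correction term. -/
theorem sum_nuCoeff_eq (X : ℕ) :
    ∑ n ∈ Finset.Icc 1 X, nuCoeff n = ∑ m ∈ Finset.Icc 1 (Nat.sqrt X),
      ∑ n ∈ Finset.Ioc m (X / m), (Real.log n - Real.log m) ^ 2 := by
  set G : ℕ × ℕ → ℝ := fun p => (Real.log p.1 - Real.log p.2) ^ 2 / 2 with hG
  set T : Finset (ℕ × ℕ) := (Finset.Icc 1 X ×ˢ Finset.Icc 1 X).filter (fun p => p.1 * p.2 ≤ X)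
    with hT
  have h1 : ∑ n ∈ Finset.Icc 1 X, nuCoeff n = ∑ p ∈ T, G p := by
    have hmaps : ∀ p ∈ T, p.1 * p.2 ∈ Finset.Icc 1 X := by
      intro p hp
      simp only [hT, Finset.mem_filter, Finset.mem_product, Finset.mem_Icc] at hp
      exact Finset.mem_Icc.2 ⟨Nat.mul_pos (by omega) (by omega), hp.2⟩
    rw [← Finset.sum_fiberwise_of_maps_to hmaps]
    refine Finset.sum_congr rfl fun n hn => ?_
    rw [nuCoeff_eq_half_sum_sq]
    refine Finset.sum_congr ?_ fun _ _ => rfl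
    have hn' := Finset.mem_Icc.1 hn
    ext p
    simp only [hT, Nat.mem_divisorsAntidiagonal, Finset.mem_filter, Finset.mem_product,
      Finset.mem_Icc]
    constructor
    · rintro ⟨hp, hn0⟩
      have ha : 0 < p.1 := Nat.pos_of_ne_zero fun h => by simp [h] at hp; omega
      have hb : 0 < p.2 := Nat.pos_of_ne_zero fun h => by simp [h] at hp; omega
      have := Nat.le_mul_of_pos_right p.1 hb
      have := Nat.le_mul_of_pos_left p.2 ha
      exact ⟨⟨⟨⟨ha, by omega⟩, hb, by omega⟩, by omega⟩, hp⟩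
    · rintro ⟨_, hp⟩
      exact ⟨hp, by omega⟩
  have h2 : ∑ p ∈ T, G p = ∑ p ∈ T.filter (fun p => p.1 < p.2), 2 * G p := by
    have hswap : ∑ p ∈ T.filter (fun p => p.2 < p.1), G p =
        ∑ p ∈ T.filter (fun p => p.1 < p.2), G p := by
      refine Finset.sum_nbij' Prod.swap Prod.swap ?_ ?_ (fun _ _ => Prod.swap_swap _)
        (fun _ _ => Prod.swap_swap _) ?_
      · intro p hp
        simp only [hT, Finset.mem_filter, Finset.mem_product, Prod.fst_swap, Prod.snd_swap,
          mul_comm p.2] at hp ⊢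
        tauto
      · intro p hp
        simp only [hT, Finset.mem_filter, Finset.mem_product, Prod.fst_swap, Prod.snd_swap,
          mul_comm p.2] at hp ⊢
        tauto
      · intro p _
        simp only [hG, Prod.fst_swap, Prod.snd_swap]
        ring
    have hle : ∑ p ∈ T.filter (fun p => ¬ p.1 < p.2), G p =
        ∑ p ∈ T.filter (fun p => p.2 < p.1), G p := by
      symm
      refine Finset.sum_subset ?_ ?_
      · intro p hp
        simp only [Finset.mem_filter] at hp ⊢
        exact ⟨hp.1, by omega⟩
      · intro p hp hp'
        simp only [Finset.mem_filter, not_and] at hp hp'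
        have : p.1 = p.2 := by have := hp' hp.1; omega
        simp [hG, this]
    rw [← Finset.sum_filter_add_sum_filter_not T (fun p => p.1 < p.2), hle, hswap,
      ← Finset.mul_sum]
    ring
  rw [h1, h2, Finset.sum_sigma']
  refine Finset.sum_nbij' (fun p => (⟨p.1, p.2⟩ : Σ _ : ℕ, ℕ)) (fun p => (p.1, p.2)) ?_ ?_
    (fun _ _ => rfl) (fun _ _ => rfl) ?_
  · intro p hp
    simp only [hT, Finset.mem_filter, Finset.mem_product, Finset.mem_Icc] at hp
    obtain ⟨⟨⟨⟨ha, _⟩, _, _⟩, hX⟩, hlt⟩ := hp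
    simp only [Finset.mem_sigma, Finset.mem_Icc, Finset.mem_Ioc]
    refine ⟨⟨ha, Nat.le_sqrt.2 ((Nat.mul_le_mul_left _ hlt.le).trans hX)⟩, hlt, ?_⟩
    rw [Nat.le_div_iff_mul_le ha, mul_comm]
    exact hX
  · rintro ⟨m, n⟩ hp
    simp only [Finset.mem_sigma, Finset.mem_Icc, Finset.mem_Ioc] at hp
    obtain ⟨⟨hm, _⟩, hlt, hn⟩ := hp
    rw [Nat.le_div_iff_mul_le hm] at hn
    have := Nat.le_mul_of_pos_right n hm
    simp only [hT, Finset.mem_filter, Finset.mem_product, Finset.mem_Icc]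
    refine ⟨⟨⟨⟨hm, by omega⟩, by omega, by omega⟩, ?_⟩, hlt⟩
    rw [mul_comm]
    exact hn
  · intro p _
    simp only [hG]
    ring

/-! ### Euler–Maclaurin summation -/

/-- The continuous periodic antiderivative `({t}² - {t}) / 2` of the sawtooth function. -/
noncomputable def sawtoothPrim (t : ℝ) : ℝ := (Int.fract t ^ 2 - Int.fract t) / 2

theorem continuous_sawtoothPrim : Continuous sawtoothPrim := by
  have h : ContinuousOn (fun u : ℝ => (u ^ 2 - u) / 2) (Set.Icc 0 1) :=
    Continuous.continuousOn (by fun_prop)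
  exact h.comp_fract'' (by norm_num)

theorem abs_sawtoothPrim_le (t : ℝ) : |sawtoothPrim t| ≤ 1 := by
  have h1 := Int.fract_nonneg t
  have h2 := (Int.fract_lt_one t).le
  unfold sawtoothPrim
  rw [abs_le]
  constructor <;> nlinarith

theorem hasDerivWithinAt_sawtoothPrim (t : ℝ) :
    HasDerivWithinAt sawtoothPrim (sawtooth t) (Set.Ioi t) t := by
  have h1 : HasDerivAt (fun s : ℝ => ((s - ⌊t⌋) ^ 2 - (s - ⌊t⌋)) / 2) (sawtooth t) t := by
    have h := (((hasDerivAt_id t).sub_const (⌊t⌋ : ℝ)).pow 2).sub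
      ((hasDerivAt_id t).sub_const (⌊t⌋ : ℝ))
    refine (h.div_const 2).congr_deriv ?_
    simp only [id, sawtooth_eq]
    norm_num
    ring
  refine h1.hasDerivWithinAt.congr_of_eventuallyEq ?_ ?_
  · have hmem : Set.Ioo t (⌊t⌋ + 1 : ℝ) ∈ 𝓝[>] t := Ioo_mem_nhdsGT (Int.lt_floor_add_one t)
    filter_upwards [hmem] with s hs
    have : ⌊s⌋ = ⌊t⌋ := Int.floor_eq_iff.2 ⟨(Int.floor_le t).trans hs.1.le, hs.2⟩
    rw [sawtoothPrim, Int.fract, this]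
  · rfl

/-- Euler–Maclaurin summation between arbitrary real endpoints, with the second derivative of the
summand dominated by the derivative of `V`. -/
theorem abs_sum_sub_euler_maclaurin_le {a b : ℝ} (ha : 0 ≤ a) (hab : a ≤ b)
    {F g g' g'' V v : ℝ → ℝ}
    (hF : ∀ t ∈ Set.Icc a b, HasDerivAt F (g t) t)
    (hg : ∀ t ∈ Set.Icc a b, HasDerivAt g (g' t) t)
    (hg' : ∀ t ∈ Set.Icc a b, HasDerivAt g' (g'' t) t)
    (hg'' : ContinuousOn g'' (Set.Icc a b))
    (hV : ∀ t ∈ Set.Icc a b, HasDerivAt V (v t) t) (hv : ContinuousOn v (Set.Icc a b))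
    (hgv : ∀ t ∈ Set.Icc a b, |g'' t| ≤ v t) :
    |∑ n ∈ Finset.Ioc ⌊a⌋₊ ⌊b⌋₊, g n -
      (F b - F a - sawtooth b * g b + sawtooth a * g a)| ≤ |g' a| + |g' b| + (V b - V a) := by
  have hcF : ContinuousOn F (Set.Icc a b) := fun t ht => (hF t ht).continuousAt.continuousWithinAt
  have hcg : ContinuousOn g (Set.Icc a b) := fun t ht => (hg t ht).continuousAt.continuousWithinAt
  have hcg' : ContinuousOn g' (Set.Icc a b) :=
    fun t ht => (hg' t ht).continuousAt.continuousWithinAt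
  have hu : Set.uIcc a b = Set.Icc a b := Set.uIcc_of_le hab
  have hcount : ∀ t : ℝ, 0 ≤ t → ∑ _k ∈ Finset.Icc 0 ⌊t⌋₊, (1 : ℝ) = t + 1 / 2 - sawtooth t := by
    intro t ht
    have h1 : (⌊t⌋₊ : ℝ) = ⌊t⌋ := by
      rw [← Int.cast_natCast, Int.natCast_floor_eq_floor ht]
    rw [Finset.sum_const, Nat.card_Icc, sawtooth_eq, nsmul_eq_mul, mul_one]
    push_cast
    rw [h1]
    ring
  have hderiv : Set.EqOn (deriv g) g' (Set.Icc a b) := fun t ht => (hg t ht).deriv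
  have habel := sum_mul_eq_sub_sub_integral_mul (fun _ => (1 : ℝ)) ha hab
    (f := g) (fun t ht => (hg t ht).differentiableAt)
    ((hcg'.congr hderiv).integrableOn_Icc)
  have hint0 : ∫ t in Set.Ioc a b, deriv g t * ∑ _k ∈ Finset.Icc 0 ⌊t⌋₊, (1 : ℝ) =
      ∫ t in a..b, g' t * (t + 1 / 2 - sawtooth t) := by
    rw [intervalIntegral.integral_of_le hab]
    refine MeasureTheory.setIntegral_congr_fun measurableSet_Ioc fun t ht => ?_
    have ht' : t ∈ Set.Icc a b := ⟨ht.1.le, ht.2⟩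
    rw [hderiv ht', hcount t (ha.trans ht'.1)]
  have hfloor : IntervalIntegrable (fun t : ℝ => t + 1 / 2 - sawtooth t) MeasureTheory.volume
      a b := by
    have : Monotone (fun t : ℝ => t + 1 / 2 - sawtooth t) := by
      intro s t hst
      have h : (⌊s⌋ : ℝ) ≤ ⌊t⌋ := by exact_mod_cast Int.floor_le_floor hst
      simp only [sawtooth_eq]
      linarith
    exact this.intervalIntegrable
  have hI1 : IntervalIntegrable (fun t : ℝ => g' t * (t + 1 / 2 - sawtooth t))
      MeasureTheory.volume a b := hfloor.continuousOn_mul (hu ▸ hcg')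
  have hI2 : IntervalIntegrable (fun t : ℝ => sawtoothPrim t * g'' t)
      MeasureTheory.volume a b := by
    refine ContinuousOn.intervalIntegrable ?_
    rw [hu]
    exact continuous_sawtoothPrim.continuousOn.mul hg''
  -- The integrand is the right derivative of one explicit function, which performs both partial
  -- integrations at once.
  have hparts : ∫ t in a..b, (g' t * (t + 1 / 2 - sawtooth t) - sawtoothPrim t * g'' t) =
      ((b + 1 / 2) * g b - F b - sawtoothPrim b * g' b) -
        ((a + 1 / 2) * g a - F a - sawtoothPrim a * g' a) := by
    refine intervalIntegral.integral_eq_sub_of_hasDeriv_right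
      (f := fun t => (t + 1 / 2) * g t - F t - sawtoothPrim t * g' t) ?_ ?_ (hI1.sub hI2)
    · rw [hu]
      exact ((((continuous_id.add continuous_const).continuousOn).mul hcg).sub hcF).sub
        (continuous_sawtoothPrim.continuousOn.mul hcg')
    · intro t ht
      rw [min_eq_left hab, max_eq_right hab] at ht
      have ht' : t ∈ Set.Icc a b := ⟨ht.1.le, ht.2.le⟩
      have h := (((((hasDerivAt_id t).add_const (1 / 2 : ℝ)).mul (hg t ht')).sub
        (hF t ht')).hasDerivWithinAt (s := Set.Ioi t)).sub
        ((hasDerivWithinAt_sawtoothPrim t).mul (hg' t ht').hasDerivWithinAt)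
      refine h.congr_deriv ?_
      simp only [id]
      ring
  rw [intervalIntegral.integral_sub hI1 hI2] at hparts
  have hrem : |∫ t in a..b, sawtoothPrim t * g'' t| ≤ V b - V a := by
    have hvI : IntervalIntegrable v MeasureTheory.volume a b :=
      ContinuousOn.intervalIntegrable (hu ▸ hv)
    rw [← intervalIntegral.integral_eq_sub_of_hasDerivAt (fun t ht => hV t (hu ▸ ht)) hvI]
    rw [← Real.norm_eq_abs]
    refine intervalIntegral.norm_integral_le_of_norm_le hab
      (Filter.Eventually.of_forall fun t ht => ?_) hvI
    have ht' : t ∈ Set.Icc a b := ⟨ht.1.le, ht.2⟩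
    rw [Real.norm_eq_abs, abs_mul]
    calc |sawtoothPrim t| * |g'' t| ≤ 1 * |g'' t| := by
          gcongr
          exact abs_sawtoothPrim_le t
      _ ≤ v t := by rw [one_mul]; exact hgv t ht'
  have hP : ∀ t, |sawtoothPrim t * g' t| ≤ |g' t| := by
    intro t
    rw [abs_mul]
    exact mul_le_of_le_one_left (abs_nonneg _) (abs_sawtoothPrim_le t)
  rw [hint0, hcount a ha, hcount b (ha.trans hab)] at habel
  simp only [mul_one] at habel
  have e : ∑ n ∈ Finset.Ioc ⌊a⌋₊ ⌊b⌋₊, g n -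
      (F b - F a - sawtooth b * g b + sawtooth a * g a) =
      sawtoothPrim b * g' b - sawtoothPrim a * g' a -
        ∫ t in a..b, sawtoothPrim t * g'' t := by
    rw [habel]
    linarith
  rw [e]
  have h1 := abs_sub (sawtoothPrim b * g' b - sawtoothPrim a * g' a)
    (∫ t in a..b, sawtoothPrim t * g'' t)
  have h2 := abs_sub (sawtoothPrim b * g' b) (sawtoothPrim a * g' a)
  linarith [hP a, hP b]

/-- The inner sum of the hyperbola method. At the lower endpoint `m` both the summand and its
derivative vanish, so only the endpoint `y` contributes a sawtooth term. -/
theorem abs_sum_sq_log_sub_le {m : ℕ} (hm : 0 < m) {y Λ : ℝ} (hy : (m : ℝ) ≤ y)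
    (hΛ : Real.log y - Real.log m ≤ Λ) :
    |∑ n ∈ Finset.Ioc m ⌊y⌋₊, (Real.log n - Real.log m) ^ 2 -
      (y * ((Real.log y - Real.log m) ^ 2 - 2 * (Real.log y - Real.log m) + 2) - 2 * m -
        sawtooth y * (Real.log y - Real.log m) ^ 2)| ≤ (2 + 4 * Λ) / m := by
  have hm' : (0 : ℝ) < m := by exact_mod_cast hm
  have hpos : ∀ t ∈ Set.Icc (m : ℝ) y, 0 < t := fun t ht => hm'.trans_le ht.1
  have hlog : ∀ t ∈ Set.Icc (m : ℝ) y, HasDerivAt (fun t => Real.log t - Real.log m) (1 / t) t := by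
    intro t ht
    rw [one_div]
    exact (Real.hasDerivAt_log (hpos t ht).ne').sub_const _
  have hlog0 : ∀ t ∈ Set.Icc (m : ℝ) y, 0 ≤ Real.log t - Real.log m := by
    intro t ht
    linarith [Real.log_le_log hm' ht.1]
  have hlogΛ : ∀ t ∈ Set.Icc (m : ℝ) y, Real.log t - Real.log m ≤ Λ := by
    intro t ht
    linarith [Real.log_le_log (hpos t ht) ht.2]
  have hΛ0 : 0 ≤ Λ := (hlog0 y ⟨hy, le_rfl⟩).trans hΛ
  have hcont : ContinuousOn Real.log (Set.Icc (m : ℝ) y) := fun t ht =>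
    (Real.continuousAt_log (hpos t ht).ne').continuousWithinAt
  have hsq : ∀ t ∈ Set.Icc (m : ℝ) y, t ^ 2 ≠ 0 := fun t ht => (pow_pos (hpos t ht) 2).ne'
  have h := abs_sum_sub_euler_maclaurin_le (a := m) (b := y) hm'.le hy
    (F := fun t => t * ((Real.log t - Real.log m) ^ 2 - 2 * (Real.log t - Real.log m) + 2))
    (g := fun t => (Real.log t - Real.log m) ^ 2)
    (g' := fun t => 2 * (Real.log t - Real.log m) / t)
    (g'' := fun t => (2 - 2 * (Real.log t - Real.log m)) / t ^ 2)
    (V := fun t => -(2 * (1 + Λ)) / t) (v := fun t => 2 * (1 + Λ) / t ^ 2)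
    (fun t ht => by
      have ht0 := (hpos t ht).ne'
      refine ((hasDerivAt_id t).mul ((((hlog t ht).pow 2).sub
        ((hlog t ht).const_mul 2)).add_const 2)).congr_deriv ?_
      simp
      field_simp
      ring)
    (fun t ht => by
      refine ((hlog t ht).pow 2).congr_deriv ?_
      simp
      ring)
    (fun t ht => by
      have ht0 := (hpos t ht).ne'
      refine (((hlog t ht).const_mul 2).div (hasDerivAt_id t) ht0).congr_deriv ?_
      simp
      field_simp)
    ((continuousOn_const.sub (continuousOn_const.mul (hcont.sub continuousOn_const))).div
      (continuousOn_id.pow 2) hsq)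
    (fun t ht => by
      have ht0 := (hpos t ht).ne'
      refine ((hasDerivAt_const t (-(2 * (1 + Λ)))).div (hasDerivAt_id t) ht0).congr_deriv ?_
      simp)
    (continuousOn_const.div (continuousOn_id.pow 2) hsq)
    (fun t ht => by
      have ht2 : 0 < t ^ 2 := pow_pos (hpos t ht) 2
      rw [abs_div, abs_of_pos ht2]
      refine div_le_div_of_nonneg_right ?_ ht2.le
      rw [abs_le]
      constructor <;> linarith [hlog0 t ht, hlogΛ t ht])
  simp only [Nat.floor_natCast, sub_self] at h
  have hy0 : 0 < y := hm'.trans_le hy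
  have e : ∀ A : ℝ, A - (y * ((Real.log y - Real.log m) ^ 2 - 2 * (Real.log y - Real.log m) + 2) -
      2 * m - sawtooth y * (Real.log y - Real.log m) ^ 2) = A -
      (y * ((Real.log y - Real.log m) ^ 2 - 2 * (Real.log y - Real.log m) + 2) -
      m * (0 ^ 2 - 2 * 0 + 2) - sawtooth y * (Real.log y - Real.log m) ^ 2 +
        sawtooth m * 0 ^ 2) := by
    intro A
    ring
  rw [e]
  refine h.trans ?_
  rw [mul_zero, zero_div, abs_zero, zero_add, abs_div, abs_of_pos hy0,
    abs_of_nonneg (by linarith [hlog0 y ⟨hy, le_rfl⟩])]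
  have h1 : 2 * (Real.log y - Real.log m) / y ≤ 2 * Λ / m := by gcongr
  have h2 : 0 ≤ 2 * (1 + Λ) / y := by positivity
  have e2 : (2 + 4 * Λ) / m = 2 * Λ / m + 2 * (1 + Λ) / m := by ring
  rw [e2, neg_div, neg_div]
  linarith

/-! ### Partial sums and the Stieltjes constants -/

theorem stieltjesConst_zero : stieltjesConst 0 = Real.eulerMascheroniConstant := by
  refine tendsto_nhds_unique (tendsto_stieltjesSeq 0) ?_
  refine Real.tendsto_harmonic_sub_log.congr fun N => ?_
  rw [harmonic_eq_sum_Icc, stieltjesSeq]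
  push_cast
  simp

theorem tendsto_quadratic_log_div_atTop (c₀ c₁ c₂ : ℝ) :
    Tendsto (fun t : ℝ => (c₀ + c₁ * Real.log t + c₂ * Real.log t ^ 2) / t) atTop (𝓝 0) := by
  have h := fun n : ℕ => Real.tendsto_pow_log_div_mul_add_atTop 1 0 n one_ne_zero
  have h1 := (((h 0).const_mul c₀).add ((h 1).const_mul c₁)).add ((h 2).const_mul c₂)
  simp only [mul_zero, add_zero] at h1
  refine h1.congr fun t => ?_
  ring

theorem tendsto_quadratic_log_div_sq_atTop (c₀ c₁ c₂ : ℝ) :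
    Tendsto (fun t : ℝ => (c₀ + c₁ * Real.log t + c₂ * Real.log t ^ 2) / t ^ 2) atTop (𝓝 0) := by
  have h := (tendsto_quadratic_log_div_atTop c₀ c₁ c₂).mul tendsto_inv_atTop_zero
  rw [mul_zero] at h
  refine h.congr fun t => ?_
  rw [← div_eq_mul_inv, div_div, ← sq]

/-- Partial sums of `(c₀ + c₁ log n + c₂ log² n) / n` through the Stieltjes constants, with the
sawtooth term at the real endpoint made explicit. -/
theorem abs_sum_quadratic_log_div_sub_le {c₀ c₁ c₂ S : ℝ} (h₀ : |c₀| ≤ S) (h₁ : |c₁| ≤ S)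
    (h₂ : |c₂| ≤ S) {X : ℝ} (hX : 1 ≤ X) :
    |∑ n ∈ Finset.Icc 1 ⌊X⌋₊, (c₀ + c₁ * Real.log n + c₂ * Real.log n ^ 2) / n -
      (c₀ * (Real.log X + stieltjesConst 0) + c₁ * (Real.log X ^ 2 / 2 + stieltjesConst 1) +
        c₂ * (Real.log X ^ 3 / 3 + stieltjesConst 2) -
        sawtooth X * ((c₀ + c₁ * Real.log X + c₂ * Real.log X ^ 2) / X))| ≤
      5 * S * (2 + Real.log X) ^ 2 / X ^ 2 := by
  set g : ℝ → ℝ := fun t => (c₀ + c₁ * Real.log t + c₂ * Real.log t ^ 2) / t with hg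
  set F : ℝ → ℝ := fun t => c₀ * Real.log t + c₁ * (Real.log t ^ 2 / 2) +
    c₂ * (Real.log t ^ 3 / 3) with hF
  set g' : ℝ → ℝ := fun t => ((c₁ - c₀) + (2 * c₂ - c₁) * Real.log t +
    (-c₂) * Real.log t ^ 2) / t ^ 2 with hg'
  set g'' : ℝ → ℝ := fun t => ((2 * c₂ - 3 * c₁ + 2 * c₀) + (2 * c₁ - 6 * c₂) * Real.log t +
    2 * c₂ * Real.log t ^ 2) / t ^ 3 with hg''
  set V : ℝ → ℝ := fun t => -(4 * S * (2 + Real.log t) ^ 2) / t ^ 2 with hV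
  set v : ℝ → ℝ := fun t => 8 * S * (2 + Real.log t) * (1 + Real.log t) / t ^ 3 with hv
  have hX0 : 0 < X := by linarith
  have hS : 0 ≤ S := (abs_nonneg _).trans h₀
  obtain ⟨h₀l, h₀u⟩ := abs_le.1 h₀
  obtain ⟨h₁l, h₁u⟩ := abs_le.1 h₁
  obtain ⟨h₂l, h₂u⟩ := abs_le.1 h₂
  have hlog : ∀ t : ℝ, 1 ≤ t → HasDerivAt Real.log (1 / t) t := by
    intro t ht
    rw [one_div]
    exact Real.hasDerivAt_log (by linarith)
  -- Summation over `(X, N]`; the asserted formula is the limit `N → ∞`. The function `V` is chosen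
  -- so that `V' = v ≥ |g''|` on `[1, ∞)` without leaving the quadratics in `log`.
  have hEM : ∀ N : ℕ, X ≤ N → |∑ n ∈ Finset.Ioc ⌊X⌋₊ N, g n -
      (F N - F X - sawtooth N * g N + sawtooth X * g X)| ≤ |g' X| + |g' N| + (V N - V X) := by
    intro N hN
    have hone : ∀ t ∈ Set.Icc X (N : ℝ), 1 ≤ t := fun t ht => hX.trans ht.1
    have hcont : ContinuousOn Real.log (Set.Icc X (N : ℝ)) := fun t ht =>
      (hlog t (hone t ht)).continuousAt.continuousWithinAt
    have hcube : ∀ t ∈ Set.Icc X (N : ℝ), t ^ 3 ≠ 0 := fun t ht =>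
      (pow_pos (by linarith [hone t ht]) 3).ne'
    have h := abs_sum_sub_euler_maclaurin_le (a := X) (b := N) hX0.le hN
      (F := F) (g := g) (g' := g') (g'' := g'') (V := V) (v := v)
      (fun t ht => by
        have ht0 : t ≠ 0 := by linarith [hone t ht]
        have hl := hlog t (hone t ht)
        refine (((hl.const_mul c₀).add (((hl.pow 2).div_const 2).const_mul c₁)).add
          (((hl.pow 3).div_const 3).const_mul c₂)).congr_deriv ?_
        simp only [hg]
        field_simp
        push_cast
        ring)
      (fun t ht => by
        have ht0 : t ≠ 0 := by linarith [hone t ht]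
        have hl := hlog t (hone t ht)
        refine ((((hl.const_mul c₁).const_add c₀).add ((hl.pow 2).const_mul c₂)).div
          (hasDerivAt_id t) ht0).congr_deriv ?_
        simp only [hg', id]
        field_simp
        push_cast
        simp
        ring)
      (fun t ht => by
        have ht0 : t ≠ 0 := by linarith [hone t ht]
        have hl := hlog t (hone t ht)
        refine ((((hl.const_mul (2 * c₂ - c₁)).const_add (c₁ - c₀)).add
          ((hl.pow 2).const_mul (-c₂))).div ((hasDerivAt_id t).pow 2)
          (pow_ne_zero 2 ht0)).congr_deriv ?_
        simp only [hg'', id]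
        field_simp
        push_cast
        simp
        ring)
      (((continuousOn_const.add (continuousOn_const.mul hcont)).add
        (continuousOn_const.mul (hcont.pow 2))).div (continuousOn_id.pow 3) hcube)
      (fun t ht => by
        have ht0 : t ≠ 0 := by linarith [hone t ht]
        have hl := hlog t (hone t ht)
        refine ((((hl.const_add 2).pow 2).const_mul (4 * S)).neg.div ((hasDerivAt_id t).pow 2)
          (pow_ne_zero 2 ht0)).congr_deriv ?_
        simp only [hv, id]
        field_simp
        push_cast
        simp
        ring)
      (((continuousOn_const.mul (continuousOn_const.add hcont)).mul
        (continuousOn_const.add hcont)).div (continuousOn_id.pow 3) hcube)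
      (fun t ht => by
        have ht0 : 0 < t := by linarith [hone t ht]
        have ht3 : 0 < t ^ 3 := pow_pos ht0 3
        have hl0 := Real.log_nonneg (hone t ht)
        have hSl : 0 ≤ S * Real.log t := mul_nonneg hS hl0
        have hSl2 : 0 ≤ S * Real.log t ^ 2 := mul_nonneg hS (sq_nonneg _)
        simp only [hg'', hv]
        rw [abs_div, abs_of_pos ht3]
        refine div_le_div_of_nonneg_right ?_ ht3.le
        rw [abs_le]
        constructor <;> nlinarith [mul_nonneg (by linarith : 0 ≤ S - c₁) hl0,
          mul_nonneg (by linarith : 0 ≤ S + c₁) hl0, mul_nonneg (by linarith : 0 ≤ S - c₂) hl0,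
          mul_nonneg (by linarith : 0 ≤ S + c₂) hl0,
          mul_nonneg (by linarith : 0 ≤ S - c₂) (sq_nonneg (Real.log t)),
          mul_nonneg (by linarith : 0 ≤ S + c₂) (sq_nonneg (Real.log t))])
    rw [Nat.floor_natCast] at h
    exact h
  have hseq : ∀ N : ℕ, c₀ * stieltjesSeq 0 N + c₁ * stieltjesSeq 1 N + c₂ * stieltjesSeq 2 N =
      ∑ n ∈ Finset.Icc 1 N, g n - F N := by
    intro N
    have e : ∑ n ∈ Finset.Icc 1 N, g n = c₀ * ∑ n ∈ Finset.Icc 1 N, Real.log n ^ 0 / n +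
        c₁ * ∑ n ∈ Finset.Icc 1 N, Real.log n ^ 1 / n +
        c₂ * ∑ n ∈ Finset.Icc 1 N, Real.log n ^ 2 / n := by
      rw [Finset.mul_sum, Finset.mul_sum, Finset.mul_sum, ← Finset.sum_add_distrib,
        ← Finset.sum_add_distrib]
      refine Finset.sum_congr rfl fun n _ => ?_
      simp only [hg]
      ring
    rw [e]
    simp only [stieltjesSeq, hF]
    push_cast
    ring
  have hsplit : ∀ N : ℕ, X ≤ N → ∑ n ∈ Finset.Icc 1 N, g n =
      ∑ n ∈ Finset.Icc 1 ⌊X⌋₊, g n + ∑ n ∈ Finset.Ioc ⌊X⌋₊ N, g n := by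
    intro N hN
    have : ⌊X⌋₊ ≤ N := Nat.floor_le_of_le hN
    rw [show Finset.Icc 1 N = Finset.Ioc 0 N from rfl,
      show Finset.Icc 1 ⌊X⌋₊ = Finset.Ioc 0 ⌊X⌋₊ from rfl,
      Finset.sum_Ioc_consecutive _ (Nat.zero_le _) this]
  have hsaw : ∀ N : ℕ, sawtooth N = -(1 / 2) := by
    intro N
    simp [sawtooth]
  have hcast := tendsto_natCast_atTop_atTop (R := ℝ)
  have hlim1 : Tendsto (fun N : ℕ => |c₀ * stieltjesSeq 0 N + c₁ * stieltjesSeq 1 N +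
      c₂ * stieltjesSeq 2 N - ∑ n ∈ Finset.Icc 1 ⌊X⌋₊, g n + F X - sawtooth X * g X +
        -(1 / 2) * g N|) atTop (𝓝 |c₀ * stieltjesConst 0 + c₁ * stieltjesConst 1 +
      c₂ * stieltjesConst 2 - ∑ n ∈ Finset.Icc 1 ⌊X⌋₊, g n + F X - sawtooth X * g X +
        -(1 / 2) * 0|) :=
    (((((((tendsto_stieltjesSeq 0).const_mul c₀).add
      ((tendsto_stieltjesSeq 1).const_mul c₁)).add
      ((tendsto_stieltjesSeq 2).const_mul c₂)).sub_const _).add_const _).sub_const _ |>.add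
      (((tendsto_quadratic_log_div_atTop c₀ c₁ c₂).comp hcast).const_mul _)).abs
  have hlim2 : Tendsto (fun N : ℕ => |g' X| + |g' N| + (0 - V X)) atTop
      (𝓝 (|g' X| + |0| + (0 - V X))) :=
    (((tendsto_quadratic_log_div_sq_atTop (c₁ - c₀) (2 * c₂ - c₁) (-c₂)).comp
      hcast).abs.const_add _).add_const _
  have hle := le_of_tendsto_of_tendsto hlim1 hlim2 (by
    filter_upwards [eventually_ge_atTop ⌈X⌉₊] with N hN
    have hN' : X ≤ N := (Nat.le_ceil X).trans (by exact_mod_cast hN)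
    have h := hEM N hN'
    have hVN : V N ≤ 0 := by
      simp only [hV]
      rw [neg_div, neg_nonpos]
      positivity
    have e : c₀ * stieltjesSeq 0 N + c₁ * stieltjesSeq 1 N +
      c₂ * stieltjesSeq 2 N - ∑ n ∈ Finset.Icc 1 ⌊X⌋₊, g n + F X - sawtooth X * g X +
        -(1 / 2) * g N = ∑ n ∈ Finset.Ioc ⌊X⌋₊ N, g n -
      (F N - F X - sawtooth N * g N + sawtooth X * g X) := by
      rw [hseq, hsplit N hN', hsaw]
      ring
    rw [e]
    linarith)
  have hl0 := Real.log_nonneg hX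
  have hg'X : |g' X| ≤ S * (2 + Real.log X) ^ 2 / X ^ 2 := by
    have hX2 : 0 < X ^ 2 := pow_pos hX0 2
    have hSl : 0 ≤ S * Real.log X := mul_nonneg hS hl0
    simp only [hg']
    rw [abs_div, abs_of_pos hX2]
    refine div_le_div_of_nonneg_right ?_ hX2.le
    rw [abs_le]
    constructor <;> nlinarith [mul_nonneg (by linarith : 0 ≤ S - c₁) hl0,
      mul_nonneg (by linarith : 0 ≤ S + c₁) hl0, mul_nonneg (by linarith : 0 ≤ S - c₂) hl0,
      mul_nonneg (by linarith : 0 ≤ S + c₂) hl0,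
      mul_nonneg (by linarith : 0 ≤ S - c₂) (sq_nonneg (Real.log X)),
      mul_nonneg (by linarith : 0 ≤ S + c₂) (sq_nonneg (Real.log X))]
  have hVX : 0 - V X = 4 * (S * (2 + Real.log X) ^ 2 / X ^ 2) := by
    simp only [hV]
    ring
  rw [abs_zero, hVX] at hle
  rw [abs_sub_comm]
  have e1 : 5 * S * (2 + Real.log X) ^ 2 / X ^ 2 = 5 * (S * (2 + Real.log X) ^ 2 / X ^ 2) := by
    ring
  rw [e1]
  refine le_trans (le_of_eq ?_) (hle.trans (by linarith))
  congr 1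
  simp only [hF, hg]
  ring

/-! ### The asymptotic formula -/

/-- Partial summation against nonnegative antitone weights. -/
theorem abs_sum_mul_le_of_antitone {w g : ℕ → ℝ} {B : ℝ} (hw : ∀ m, 1 ≤ m → w (m + 1) ≤ w m)
    (hw0 : ∀ m, 0 ≤ w m) (M : ℕ) (hB : ∀ m ≤ M, |∑ n ∈ Finset.Icc 1 m, g n| ≤ B) :
    |∑ n ∈ Finset.Icc 1 M, w n * g n| ≤ w 1 * B := by
  have key : |∑ n ∈ Finset.Icc 1 M, w n * g n - w (M + 1) * ∑ n ∈ Finset.Icc 1 M, g n| ≤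
      (w 1 - w (M + 1)) * B := by
    induction M with
    | zero => simp
    | succ M ih =>
      have h1 := ih fun m hm => hB m (by omega)
      have h2 := hB (M + 1) le_rfl
      rw [Finset.sum_Icc_succ_top (by omega) (fun n => w n * g n)]
      have e : ∑ n ∈ Finset.Icc 1 M, w n * g n + w (M + 1) * g (M + 1) -
          w (M + 1 + 1) * ∑ n ∈ Finset.Icc 1 (M + 1), g n =
          (∑ n ∈ Finset.Icc 1 M, w n * g n - w (M + 1) * ∑ n ∈ Finset.Icc 1 M, g n) +
          (w (M + 1) - w (M + 1 + 1)) * ∑ n ∈ Finset.Icc 1 (M + 1), g n := by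
        rw [Finset.sum_Icc_succ_top (by omega) g]
        ring
      rw [e]
      have h3 : |(w (M + 1) - w (M + 1 + 1)) * ∑ n ∈ Finset.Icc 1 (M + 1), g n| ≤
          (w (M + 1) - w (M + 1 + 1)) * B := by
        have h4 : 0 ≤ w (M + 1) - w (M + 1 + 1) := by linarith [hw (M + 1) (by omega)]
        rw [abs_mul, abs_of_nonneg h4]
        gcongr
      linarith [abs_add_le
        (∑ n ∈ Finset.Icc 1 M, w n * g n - w (M + 1) * ∑ n ∈ Finset.Icc 1 M, g n)
        ((w (M + 1) - w (M + 1 + 1)) * ∑ n ∈ Finset.Icc 1 (M + 1), g n)]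
  have h5 : |w (M + 1) * ∑ n ∈ Finset.Icc 1 M, g n| ≤ w (M + 1) * B := by
    rw [abs_mul, abs_of_nonneg (hw0 _)]
    exact mul_le_mul_of_nonneg_left (hB M le_rfl) (hw0 _)
  have h6 := abs_add_le (∑ n ∈ Finset.Icc 1 M, w n * g n - w (M + 1) * ∑ n ∈ Finset.Icc 1 M, g n)
    (w (M + 1) * ∑ n ∈ Finset.Icc 1 M, g n)
  rw [sub_add_cancel] at h6
  linarith

theorem abs_sum_log_sq_mul_sawtooth_le {x c : ℝ} (hc : 1 ≤ c) (hcx : c ^ 3 = x) {M : ℕ}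
    (hM : (M : ℝ) ^ 2 ≤ x) :
    |∑ m ∈ Finset.Icc 1 M, (Real.log x - 2 * Real.log m) ^ 2 * sawtooth (x / m)| ≤
      1800 * c * (1 + Real.log x) ^ 4 := by
  have hx1 : 1 ≤ x := by rw [← hcx]; exact one_le_pow₀ hc
  have hx : 0 < x := by linarith
  have hlx := Real.log_nonneg hx1
  -- Cutting the logarithm off at zero makes the weights antitone on the whole range.
  have hcongr : ∑ m ∈ Finset.Icc 1 M, (Real.log x - 2 * Real.log m) ^ 2 * sawtooth (x / m) =
      ∑ m ∈ Finset.Icc 1 M, Real.posLog (x / (m : ℝ) ^ 2) ^ 2 * sawtooth (x / m) := by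
    refine Finset.sum_congr rfl fun m hm => ?_
    have hm' := Finset.mem_Icc.1 hm
    have hm0 : (0 : ℝ) < m := by exact_mod_cast hm'.1
    have hmM : (m : ℝ) ≤ M := by exact_mod_cast hm'.2
    have h1 : 1 ≤ x / (m : ℝ) ^ 2 := by
      rw [le_div_iff₀ (by positivity), one_mul]
      exact le_trans (by gcongr) hM
    rw [Real.posLog_eq_log (h1.trans (le_abs_self _)), Real.log_div hx.ne' (by positivity),
      Real.log_pow]
    norm_num
  have hB : ∀ m ≤ M, |∑ n ∈ Finset.Icc 1 m, sawtooth (x / n)| ≤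
      1800 * c * (1 + Real.log x) ^ 2 := by
    intro m hm
    refine abs_sum_sawtooth_le hc hcx (le_trans ?_ hM)
    have : (m : ℝ) ≤ M := by exact_mod_cast hm
    gcongr
  have hw : ∀ m : ℕ, 1 ≤ m → Real.posLog (x / ((m + 1 : ℕ) : ℝ) ^ 2) ^ 2 ≤
      Real.posLog (x / (m : ℝ) ^ 2) ^ 2 := by
    intro m hm
    have hm0 : (0 : ℝ) < m := by exact_mod_cast hm
    refine pow_le_pow_left₀ Real.posLog_nonneg (Real.posLog_le_posLog (by positivity) ?_) 2
    gcongr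
    omega
  rw [hcongr]
  refine (abs_sum_mul_le_of_antitone (w := fun m : ℕ => Real.posLog (x / (m : ℝ) ^ 2) ^ 2) hw
    (fun m => sq_nonneg _) M hB).trans ?_
  have h1 : Real.posLog (x / ((1 : ℕ) : ℝ) ^ 2) = Real.log x := by
    rw [Nat.cast_one, one_pow, div_one, Real.posLog_eq_log (hx1.trans (le_abs_self _))]
  rw [h1]
  calc Real.log x ^ 2 * (1800 * c * (1 + Real.log x) ^ 2)
      ≤ (1 + Real.log x) ^ 2 * (1800 * c * (1 + Real.log x) ^ 2) := by
        have : Real.log x ≤ 1 + Real.log x := by linarith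
        gcongr
    _ = 1800 * c * (1 + Real.log x) ^ 4 := by ring

theorem sum_Icc_natCast (M : ℕ) : ∑ m ∈ Finset.Icc 1 M, (m : ℝ) = M * (M + 1) / 2 := by
  induction M with
  | zero => simp
  | succ M ih =>
    rw [Finset.sum_Icc_succ_top (by omega), ih]
    push_cast
    ring

theorem natSqrt_floor_eq {x : ℝ} (hx : 0 ≤ x) : Nat.sqrt ⌊x⌋₊ = ⌊√x⌋₊ := by
  refine le_antisymm (Nat.le_floor (Real.le_sqrt_of_sq_le ?_)) (Nat.le_sqrt'.2 (Nat.le_floor ?_))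
  · have h : ((Nat.sqrt ⌊x⌋₊ : ℝ)) ^ 2 ≤ ⌊x⌋₊ := by exact_mod_cast Nat.sqrt_le' ⌊x⌋₊
    exact h.trans (Nat.floor_le hx)
  · push_cast
    calc (⌊√x⌋₊ : ℝ) ^ 2 ≤ √x ^ 2 := by
          gcongr
          exact Nat.floor_le (Real.sqrt_nonneg x)
      _ = x := Real.sq_sqrt hx

/-- The inner sums of the hyperbola method together, up to a power of `log x`. -/
theorem abs_sum_inner_sub_le {x : ℝ} (hx1 : 1 ≤ x) {M : ℕ} (hMX : (M : ℝ) ≤ √x) :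
    |∑ m ∈ Finset.Icc 1 M, (∑ n ∈ Finset.Ioc m (⌊x⌋₊ / m),
        (Real.log n - Real.log m) ^ 2 -
        (x * (((Real.log x ^ 2 - 2 * Real.log x + 2) + (4 - 4 * Real.log x) * Real.log m +
          4 * Real.log m ^ 2) / m) -
          2 * m - (Real.log x - 2 * Real.log m) ^ 2 * sawtooth (x / m)))| ≤
      (2 + 4 * Real.log x) * (1 + Real.log x) := by
  have hx : 0 < x := by linarith
  set l := Real.log x with hl
  have hl0 : 0 ≤ l := Real.log_nonneg hx1
  have hM2 : (M : ℝ) ^ 2 ≤ x := by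
    rw [← Real.sq_sqrt hx.le]
    gcongr
  have hinner : ∀ m ∈ Finset.Icc 1 M,
      |∑ n ∈ Finset.Ioc m (⌊x⌋₊ / m), (Real.log n - Real.log m) ^ 2 -
        (x * (((l ^ 2 - 2 * l + 2) + (4 - 4 * l) * Real.log m + 4 * Real.log m ^ 2) / m) -
          2 * m - (l - 2 * Real.log m) ^ 2 * sawtooth (x / m))| ≤ (2 + 4 * l) * (m : ℝ)⁻¹ := by
    intro m hm
    have hm' := Finset.mem_Icc.1 hm
    have hm0 : (0 : ℝ) < m := by exact_mod_cast hm'.1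
    have hm1 : (1 : ℝ) ≤ m := by exact_mod_cast hm'.1
    have hmM : (m : ℝ) ≤ M := by exact_mod_cast hm'.2
    have hlm : Real.log (x / m) - Real.log m = l - 2 * Real.log m := by
      rw [Real.log_div hx.ne' hm0.ne']
      ring
    have hy : (m : ℝ) ≤ x / m := by
      rw [le_div_iff₀ hm0, ← sq]
      exact le_trans (by gcongr) hM2
    have h := abs_sum_sq_log_sub_le hm'.1 hy (Λ := l)
      (by rw [hlm]; linarith [Real.log_nonneg hm1])
    rw [hlm, Nat.floor_div_natCast] at h
    have e : x * (((l ^ 2 - 2 * l + 2) + (4 - 4 * l) * Real.log m + 4 * Real.log m ^ 2) / m) -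
          2 * m - (l - 2 * Real.log m) ^ 2 * sawtooth (x / m) =
        x / m * ((l - 2 * Real.log m) ^ 2 - 2 * (l - 2 * Real.log m) + 2) - 2 * m -
        sawtooth (x / m) * (l - 2 * Real.log m) ^ 2 := by ring
    rw [e, ← div_eq_mul_inv]
    exact h
  refine (Finset.abs_sum_le_sum_abs _ _).trans ((Finset.sum_le_sum hinner).trans ?_)
  rw [← Finset.mul_sum]
  have hharm := harmonic_le_one_add_log M
  rw [harmonic_eq_sum_Icc] at hharm
  push_cast at hharm
  have h1 : Real.log M ≤ l := by
    rcases Nat.eq_zero_or_pos M with rfl | hM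
    · simpa using hl0
    · have := Real.log_le_log (by exact_mod_cast hM) hMX
      rw [Real.log_sqrt hx.le] at this
      linarith
  exact mul_le_mul_of_nonneg_left (by linarith) (by linarith)

/-- The asymptotic formula for the closed summatory function; here `c = x^{1/3}`. -/
theorem abs_sum_nuCoeff_sub_le {x c : ℝ} (hc : 1 ≤ c) (hcx : c ^ 3 = x) :
    |∑ n ∈ Finset.Icc 1 ⌊x⌋₊, nuCoeff n - x * mainPoly (Real.log x)| ≤
      2000 * c * (1 + Real.log x) ^ 4 := by
  have hx1 : 1 ≤ x := by rw [← hcx]; exact one_le_pow₀ hc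
  have hx : 0 < x := by linarith
  set l := Real.log x with hl
  have hl0 : 0 ≤ l := Real.log_nonneg hx1
  set X := √x with hXdef
  have hX1 : 1 ≤ X := Real.one_le_sqrt.2 hx1
  have hX0 : 0 < X := by linarith
  have hXX : X ^ 2 = x := Real.sq_sqrt hx.le
  have hlX : Real.log X = l / 2 := Real.log_sqrt hx.le
  set M := ⌊X⌋₊ with hMdef
  have hMX : (M : ℝ) ≤ X := Nat.floor_le hX0.le
  have hM2 : (M : ℝ) ^ 2 ≤ x := by rw [← hXX]; gcongr
  have hMs : Nat.sqrt ⌊x⌋₊ = M := natSqrt_floor_eq hx.le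
  have hsum1 := abs_sum_inner_sub_le hx1 hMX
  rw [← hl] at hsum1
  rw [Finset.sum_sub_distrib, Finset.sum_sub_distrib, Finset.sum_sub_distrib, ← Finset.mul_sum,
    ← Finset.mul_sum] at hsum1
  have hsaw := abs_sum_log_sq_mul_sawtooth_le hc hcx hM2
  rw [← hl] at hsaw
  have hmain := abs_sum_quadratic_log_div_sub_le (c₀ := l ^ 2 - 2 * l + 2) (c₁ := 4 - 4 * l)
    (c₂ := 4) (S := 4 * (1 + l) ^ 2) (by rw [abs_le]; constructor <;> nlinarith)
    (by rw [abs_le]; constructor <;> nlinarith) (by rw [abs_le]; constructor <;> nlinarith) hX1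
  rw [stieltjesConst_zero, hXX, hlX, ← hMdef] at hmain
  have hid := sum_Icc_natCast M
  have hMsaw : (M : ℝ) = X - sawtooth X - 1 / 2 := by
    have h1 : (M : ℝ) = ⌊X⌋ := by
      rw [hMdef, ← Int.cast_natCast, Int.natCast_floor_eq_floor hX0.le]
    rw [sawtooth_eq, h1]
    ring
  rw [hid] at hsum1
  rw [sum_nuCoeff_eq, hMs]
  set A := ∑ m ∈ Finset.Icc 1 M, ∑ n ∈ Finset.Ioc m (⌊x⌋₊ / m),
    (Real.log n - Real.log m) ^ 2
  set W := ∑ m ∈ Finset.Icc 1 M, (l - 2 * Real.log m) ^ 2 * sawtooth (x / m)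
  set U := ∑ n ∈ Finset.Icc 1 M,
    ((l ^ 2 - 2 * l + 2) + (4 - 4 * l) * Real.log n + 4 * Real.log n ^ 2) / (n : ℝ)
  set R := U - ((l ^ 2 - 2 * l + 2) * (l / 2 + Real.eulerMascheroniConstant) +
    (4 - 4 * l) * ((l / 2) ^ 2 / 2 + stieltjesConst 1) +
      4 * ((l / 2) ^ 3 / 3 + stieltjesConst 2) -
      sawtooth X * ((l ^ 2 - 2 * l + 2 + (4 - 4 * l) * (l / 2) + 4 * (l / 2) ^ 2) / X)) with hR
  have hxR : |x * R| ≤ 80 * (1 + l) ^ 4 := by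
    rw [abs_mul, abs_of_pos hx]
    calc x * |R| ≤ x * (5 * (4 * (1 + l) ^ 2) * (2 + l / 2) ^ 2 / x) := by gcongr
      _ = 20 * (1 + l) ^ 2 * (2 + l / 2) ^ 2 := by
        field_simp
        ring
      _ ≤ 20 * (1 + l) ^ 2 * (2 * (1 + l)) ^ 2 := by
        have : 2 + l / 2 ≤ 2 * (1 + l) := by linarith
        gcongr
      _ = 80 * (1 + l) ^ 4 := by ring
  -- The two terms of size `√x` that carry the sawtooth at `√x` cancel each other.
  have hdecomp : A - x * mainPoly l =
      (A - (x * U - 2 * (M * (M + 1) / 2) - W)) + x * R - W + (1 / 4 - sawtooth X ^ 2) := by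
    have hxX : x * (sawtooth X * ((l ^ 2 - 2 * l + 2 + (4 - 4 * l) * (l / 2) +
        4 * (l / 2) ^ 2) / X)) = 2 * X * sawtooth X := by
      rw [← hXX]
      field_simp
      ring
    rw [hR, mul_sub x U, mul_sub x (_ + _), hxX, hMsaw, mainPoly]
    linear_combination -hXX
  have hpsi : |1 / 4 - sawtooth X ^ 2| ≤ 1 := by
    have h1 := abs_le.1 (abs_sawtooth_le X)
    have h2 := sq_le_sq' h1.1 h1.2
    rw [abs_le]
    constructor <;> linarith [sq_nonneg (sawtooth X)]
  clear_value A W U R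
  have h2 : (1 + l) ^ 2 ≤ (1 + l) ^ 4 := pow_le_pow_right₀ (by linarith) (by norm_num)
  have h1 : 1 ≤ (1 + l) ^ 4 := one_le_pow₀ (by linarith)
  have hc4 : (1 + l) ^ 4 ≤ c * (1 + l) ^ 4 := le_mul_of_one_le_left (by positivity) hc
  have h5 : (2 + 4 * l) * (1 + l) ≤ 4 * (1 + l) ^ 4 := by
    calc (2 + 4 * l) * (1 + l) ≤ (4 * (1 + l)) * (1 + l) :=
          mul_le_mul_of_nonneg_right (by linarith) (by linarith)
      _ = 4 * (1 + l) ^ 2 := by ring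
      _ ≤ 4 * (1 + l) ^ 4 := by linarith
  rw [hdecomp]
  have t1 := abs_add_le ((A - (x * U - 2 * (M * (M + 1) / 2) - W)) + x * R - W)
    (1 / 4 - sawtooth X ^ 2)
  have t2 := abs_sub ((A - (x * U - 2 * (M * (M + 1) / 2) - W)) + x * R) W
  have t3 := abs_add_le (A - (x * U - 2 * (M * (M + 1) / 2) - W)) (x * R)
  linarith

theorem exists_one_add_log_pow_le {ε : ℝ} (hε : 0 < ε) :
    ∃ K : ℝ, 0 ≤ K ∧ ∀ x : ℝ, 1 ≤ x → (1 + Real.log x) ^ 4 ≤ K * x ^ ε := by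
  have hδ : 0 < ε / 4 := by positivity
  refine ⟨(1 + 1 / (ε / 4)) ^ 4, by positivity, fun x hx => ?_⟩
  have hx0 : 0 < x := by linarith
  have h1 := Real.log_le_rpow_div hx0.le hδ
  have h2 : 1 ≤ x ^ (ε / 4) := Real.one_le_rpow hx hδ.le
  have h3 : 1 + Real.log x ≤ (1 + 1 / (ε / 4)) * x ^ (ε / 4) := by
    rw [add_mul, one_mul, div_mul_eq_mul_div, one_mul]
    linarith
  have h4 := Real.log_nonneg hx
  calc (1 + Real.log x) ^ 4 ≤ ((1 + 1 / (ε / 4)) * x ^ (ε / 4)) ^ 4 := by gcongr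
    _ = (1 + 1 / (ε / 4)) ^ 4 * x ^ ε := by
      rw [mul_pow, ← Real.rpow_natCast (x ^ (ε / 4)), ← Real.rpow_mul hx0.le]
      congr 2
      push_cast
      ring

/-- The summatory function over `n < x` is the limit from the left of the one over `n ≤ y`. -/
theorem abs_nuSum_sub_le {K θ : ℝ}
    (h : ∀ y : ℝ, 1 ≤ y → |∑ n ∈ Finset.Icc 1 ⌊y⌋₊, nuCoeff n - y * mainPoly (Real.log y)| ≤
      K * y ^ θ) {x : ℝ} (hx : 1 < x) :
    |nuSum x - x * mainPoly (Real.log x)| ≤ K * x ^ θ := by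
  have hx0 : 0 < x := by linarith
  have hlog : ContinuousAt Real.log x := Real.continuousAt_log hx0.ne'
  have hpoly : Continuous mainPoly := by
    unfold mainPoly
    fun_prop
  have hl : Tendsto (fun y => |nuSum x - y * mainPoly (Real.log y)|) (𝓝[<] x)
      (𝓝 |nuSum x - x * mainPoly (Real.log x)|) := by
    have hc : ContinuousAt (fun y => |nuSum x - y * mainPoly (Real.log y)|) x :=
      (continuousAt_const.sub
        (continuousAt_id.mul (ContinuousAt.comp hpoly.continuousAt hlog))).abs
    exact hc.tendsto.mono_left nhdsWithin_le_nhds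
  have hr : Tendsto (fun y => K * y ^ θ) (𝓝[<] x) (𝓝 (K * x ^ θ)) := by
    have hc : ContinuousAt (fun y : ℝ => K * y ^ θ) x :=
      continuousAt_const.mul (Real.continuousAt_rpow_const x θ (Or.inl hx0.ne'))
    exact hc.tendsto.mono_left nhdsWithin_le_nhds
  refine le_of_tendsto_of_tendsto hl hr ?_
  have hceil : 1 < ⌈x⌉₊ := Nat.lt_ceil.2 (by exact_mod_cast hx)
  have hlt : ((⌈x⌉₊ - 1 : ℕ) : ℝ) < x := Nat.lt_ceil.1 (by omega)
  filter_upwards [Ioo_mem_nhdsLT hlt] with y hy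
  have hy1 : (1 : ℝ) ≤ y := le_trans (by exact_mod_cast (by omega : 1 ≤ ⌈x⌉₊ - 1)) hy.1.le
  have hfloor : ⌊y⌋₊ = ⌈x⌉₊ - 1 := by
    refine (Nat.floor_eq_iff (by linarith)).2 ⟨hy.1.le, ?_⟩
    rw [Nat.cast_sub hceil.le, Nat.cast_one, sub_add_cancel]
    exact hy.2.trans_le (Nat.le_ceil x)
  have h1 := h y hy1
  rw [hfloor] at h1
  have e : Finset.Icc 1 (⌈x⌉₊ - 1) = Finset.Ico 1 ⌈x⌉₊ := by
    ext n
    simp only [Finset.mem_Icc, Finset.mem_Ico]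
    omega
  rw [e] at h1
  exact h1

theorem mainTheorem4 :
    (∀ s : ℂ, 1 < s.re → LSeriesHasSum (fun n => (nuCoeff n : ℂ)) s (nu s)) ∧
    ∀ ε : ℝ, 0 < ε → ∃ C : ℝ, ∀ x : ℝ, 1 ≤ x →
      |nuSum x - x * mainPoly (Real.log x)| ≤ C * x ^ (1 / 3 + ε) := by
  refine ⟨fun s hs => LSeriesHasSum_nuCoeff hs, fun ε hε => ?_⟩
  obtain ⟨K, hK0, hK⟩ := exists_one_add_log_pow_le hε
  have hclosed : ∀ y : ℝ, 1 ≤ y →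
      |∑ n ∈ Finset.Icc 1 ⌊y⌋₊, nuCoeff n - y * mainPoly (Real.log y)| ≤
        2000 * K * y ^ (1 / 3 + ε) := by
    intro y hy
    have hy0 : 0 < y := by linarith
    have hc : 1 ≤ y ^ (1 / 3 : ℝ) := Real.one_le_rpow hy (by norm_num)
    have hcy : (y ^ (1 / 3 : ℝ)) ^ 3 = y := by
      rw [← Real.rpow_natCast, ← Real.rpow_mul hy0.le]
      norm_num
    calc _ ≤ 2000 * y ^ (1 / 3 : ℝ) * (1 + Real.log y) ^ 4 := abs_sum_nuCoeff_sub_le hc hcy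
      _ ≤ 2000 * y ^ (1 / 3 : ℝ) * (K * y ^ ε) := by
        gcongr
        exact hK y hy
      _ = 2000 * K * y ^ (1 / 3 + ε) := by
        rw [Real.rpow_add hy0]
        ring
  refine ⟨max (2000 * K) |mainPoly 0|, fun x hx => ?_⟩
  have hpos : 0 ≤ x ^ (1 / 3 + ε) := Real.rpow_nonneg (by linarith) _
  rcases hx.eq_or_lt with rfl | hx1
  · rw [Real.one_rpow, mul_one, Real.log_one, one_mul, nuSum, Nat.ceil_one, Finset.Ico_self,
      Finset.sum_empty, zero_sub, abs_neg]
    exact le_max_right _ _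
  · exact (abs_nuSum_sub_le hclosed hx1).trans
      (mul_le_mul_of_nonneg_right (le_max_left _ _) hpos)
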